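/- Positions in a string $s=s[1..n]$ over a finite totally ordered alphabet $\Sigma$ are counted from $1$, and a suffix $s[i..n]$ is represented by its starting position $i$. A Lyndon word is a nonempty primitive word that is lexicographically minimal among its conjugates (cyclic rotations). The Lyndon suffix array of $s$ is the lexicographically sorted list of those suffixes of $s$ that are Lyndon words. (1) The Lyndon suffix array can be built in linear time and space. That is, there are one word-RAM program $P$ and one constant $C$ such that for every finite totally ordered alphabet $\Sigma$ and every string $s\in\Sigma^*$ of length $n$, given as the array of the ranks $0,\dots,|\Sigma|-1$ of its letters, $P$ outputs the Lyndon suffix array of $s$ after at most $C(n+1)$ unit-cost steps, using a memory of $C(n+1)$ words, each holding a number below $C(n+|\Sigma|+1)$ (that is, words of $O(\log(n+|\Sigma|))$ bits), and a constant number of registers. (2) In the Lyndon suffix array of every such string $s$ the positions are strictly increasing (Lyndon suffixes are nested). Moreover, for every set $T\subseteq\{1,\dots,n\}$ that contains the starting positions of all Lyndon suffixes of $s$, if $T$ is listed in the lexicographic order of the corresponding suffixes, then keeping only the increasing sequence of positions, i.e. the entries larger than all earlier entries of the list, yields exactly the Lyndon suffix array of $s$. In particular this holds for the ordinary suffix array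 of $s$, where $T=\{1,\dots,n\}$. -/

import Mathlib

/-! ### Lyndon words and the Lyndon suffix array -/

namespace LyndonSA

/-- A word is primitive if it is not `u ^ k` for a nonempty word `u` and some `k ≥ 2`. -/
def IsPrimitive {α : Type*} (w : List α) : Prop :=
  ¬ ∃ (u : List α) (k : ℕ), u ≠ [] ∧ 2 ≤ k ∧ w = (List.replicate k u).flatten

/-- A Lyndon word: nonempty, primitive, and minimal, for the lexicographic order, among its
conjugates (cyclic rotations). The order on `List α` is the lexicographic (dictionary) one. -/
def IsLyndon {α : Type*} [LinearOrder α] (w : List α) : Prop :=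
  w ≠ [] ∧ IsPrimitive w ∧ ∀ i : ℕ, w ≤ w.rotate i

/-- The suffix `s[i .. n]` of `s = s[1 .. n]`; positions are counted from `1`. -/
def suffixAt {α : Type*} (s : List α) (i : ℕ) : List α := s.drop (i - 1)

open Classical in
/-- The positions `i ∈ {1, …, |s|}` that belong to `T`, listed in the lexicographic order of the
suffixes that start there. For `T = Set.univ` this is the suffix array of `s`. -/
noncomputable def suffixSort {α : Type*} [LinearOrder α] (s : List α) (T : Set ℕ) : List ℕ :=
  ((List.range' 1 s.length).filter (fun i => decide (i ∈ T))).mergeSort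
    (fun i j => decide (suffixAt s i ≤ suffixAt s j))

/-- The Lyndon suffix array: the lexicographically sorted list of the suffixes (given by their
starting positions) that are Lyndon words. -/
noncomputable def lyndonSuffixArray {α : Type*} [LinearOrder α] (s : List α) : List ℕ :=
  suffixSort s {i | IsLyndon (suffixAt s i)}

/-- The entries of a list that are larger than all the entries before them, in order. -/
def leftToRightMaxima : List ℕ → List ℕ
  | [] => []
  | x :: l => x :: (leftToRightMaxima l).filter (fun y => decide (x < y))

/-! ### A word RAM

A program works with registers (finitely many, since the program is finite) and a memory, all
holding natural numbers. Every instruction and every test of a condition takes one unit of time. -/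

/-- Structured word RAM programs; `r`, `a`, `b` are names of registers. -/
inductive Prog : Type
  /-- do nothing -/
  | skip : Prog
  /-- `r := c` -/
  | const (r c : ℕ) : Prog
  /-- `r := a + b` -/
  | add (r a b : ℕ) : Prog
  /-- `r := a - b` (truncated at `0`) -/
  | sub (r a b : ℕ) : Prog
  /-- `r := memory[a]` -/
  | load (r a : ℕ) : Prog
  /-- `memory[a] := r` -/
  | store (a r : ℕ) : Prog
  /-- `p; q` -/
  | seq (p q : Prog) : Prog
  /-- `if a < b then p else q` -/
  | ite (a b : ℕ) (p q : Prog) : Prog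
  /-- `while a < b do p` -/
  | loop (a b : ℕ) (p : Prog) : Prog

/-- Contents of the registers and of the memory. -/
structure State : Type where
  reg : ℕ → ℕ
  mem : ℕ → ℕ

/-- The state after the number `v` has been written to register `r`. -/
def State.setReg (st : State) (r v : ℕ) : State :=
  { st with reg := Function.update st.reg r v }

/-- The state after the number `v` has been written to memory cell `a`. -/
def State.setMem (st : State) (a v : ℕ) : State :=
  { st with mem := Function.update st.mem a v }

/-- `Exec W M p st st' t`: on a machine whose words hold the numbers below `W` and whose memory
consists of the `M` cells with addresses below `M`, the program `p` started in state `st` halts in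
state `st'` after exactly `t` steps. A computation that overflows a word or leaves the memory is
stuck: it has no final state. -/
inductive Exec (W M : ℕ) : Prog → State → State → ℕ → Prop
  | skip (st : State) : Exec W M Prog.skip st st 1
  | const (st : State) (r c : ℕ) (h : c < W) :
      Exec W M (Prog.const r c) st (st.setReg r c) 1
  | add (st : State) (r a b : ℕ) (h : st.reg a + st.reg b < W) :
      Exec W M (Prog.add r a b) st (st.setReg r (st.reg a + st.reg b)) 1
  | sub (st : State) (r a b : ℕ) :
      Exec W M (Prog.sub r a b) st (st.setReg r (st.reg a - st.reg b)) 1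
  | load (st : State) (r a : ℕ) (h : st.reg a < M) :
      Exec W M (Prog.load r a) st (st.setReg r (st.mem (st.reg a))) 1
  | store (st : State) (a r : ℕ) (h : st.reg a < M) :
      Exec W M (Prog.store a r) st (st.setMem (st.reg a) (st.reg r)) 1
  | seq {p q : Prog} {st₁ st₂ st₃ : State} {t₁ t₂ : ℕ}
      (h₁ : Exec W M p st₁ st₂ t₁) (h₂ : Exec W M q st₂ st₃ t₂) :
      Exec W M (Prog.seq p q) st₁ st₃ (t₁ + t₂)
  | iteTrue {a b : ℕ} {p q : Prog} {st st' : State} {t : ℕ}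
      (hc : st.reg a < st.reg b) (h : Exec W M p st st' t) :
      Exec W M (Prog.ite a b p q) st st' (1 + t)
  | iteFalse {a b : ℕ} {p q : Prog} {st st' : State} {t : ℕ}
      (hc : ¬ st.reg a < st.reg b) (h : Exec W M q st st' t) :
      Exec W M (Prog.ite a b p q) st st' (1 + t)
  | loopTrue {a b : ℕ} {p : Prog} {st₁ st₂ st₃ : State} {t₁ t₂ : ℕ}
      (hc : st₁.reg a < st₁.reg b) (h₁ : Exec W M p st₁ st₂ t₁)
      (h₂ : Exec W M (Prog.loop a b p) st₂ st₃ t₂) :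
      Exec W M (Prog.loop a b p) st₁ st₃ (1 + t₁ + t₂)
  | loopFalse {a b : ℕ} {p : Prog} (st : State) (hc : ¬ st.reg a < st.reg b) :
      Exec W M (Prog.loop a b p) st st 1

/-- Initial state for an input list `l`: the length of `l` in memory cell `0`, its entries in the
cells `1, …, |l|`, and `0` everywhere else. -/
def inputState (l : List ℕ) : State where
  reg := fun _ => 0
  mem := fun a => (l.length :: l).getD a 0

/-- The list stored in memory in the format of the input: its length in cell `0`, its entries
in the cells `1, 2, …`. -/
def State.output (st : State) : List ℕ := (List.range' 1 (st.mem 0)).map st.mem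

/-- The number that encodes the letter `a`: its rank `0, 1, …, |α| - 1` in the alphabet `α`. -/
def rank {α : Type*} [LinearOrder α] [Fintype α] (a : α) : ℕ :=
  (Finset.univ.filter (fun b : α => b < a)).card

end LyndonSA

/-!
A word is Lyndon iff it is smaller than all its proper nonempty suffixes
(`isLyndon_iff_lt_suffix`). So the suffix of `s` at position `i` is Lyndon iff it is smaller than
every suffix that starts later: the Lyndon suffixes are the record minima from right to left.
Consequently their lexicographic order is the order of their positions, and in any sorted list of
suffixes that contains all Lyndon ones a suffix is a left-to-right maximum iff no smaller suffix
starts later, i.e. iff it is Lyndon (`leftToRightMaxima_suffixSort`).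

For the algorithm, let `m` be the position of the smallest suffix `v` found so far; the next Lyndon
suffix starts at the largest `i < m` whose suffix is smaller than `v`. Write that suffix as `x v`.
As `v` is a Lyndon word, `x v < v` holds as soon as `x` is a proper prefix of `v`
(`drop_lt_of_agree_of_eq`), so the comparison never has to read beyond the `m - i` letters of `x`.
This makes a search by doubling possible: with `B` positions before `m` already excluded, the
`2 B + 1` positions before `m` are scanned from left to right, as in the Knuth-Morris-Pratt
algorithm, for the last position with a smaller suffix. After a success the scan moves on by the
smallest period of the current agreement with `v` (`lt_drop_of_isPeriod`), after a mismatch with a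
larger letter it moves on behind the mismatch (`lt_drop_of_mismatch`), and after a full occurrence
of `v` behind the occurrence (`lt_drop_of_occurrence`). The smallest periods of the prefixes of `v`
come from Duval's observation that in a Lyndon word a letter that breaks the period is always an
increase (`IsPeriod.succ_of_eq`, `IsPeriod.succ_of_lt`). Only comparisons of letters are used, so
the size of the alphabet does not enter the running time.

A scan takes time `O(B + 1)`. It either finds a position `i` with `m - i > B`, which becomes the new
`m`, or it increases `B` by `B + 1`; hence a suitable combination `200 m - 100 B` pays for
all scans, and the total time is linear (`run_stageBody`, `run_mainLoop`). Finally the marked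
positions are written out from left to right.
-/

namespace LyndonSA

/-! ### Lyndon words and their suffixes -/

/-- Two words that commute are powers of a common word. The bound `N` on the total length carries
the induction, which is Euclid's algorithm on the lengths. -/
theorem exists_flatten_replicate_of_append_comm {α : Type*} (N : ℕ) :
    ∀ u t : List α, u.length + t.length ≤ N → u ++ t = t ++ u → t ≠ [] →
      ∃ (z : List α) (a b : ℕ), z ≠ [] ∧ u = (List.replicate a z).flatten ∧
        t = (List.replicate b z).flatten := by
  induction N with
  | zero =>
    intro u t h _ ht
    exact absurd (List.length_eq_zero_iff.1 (by omega)) ht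
  | succ N ih =>
    intro u t hN h ht
    have key : ∀ u t : List α, u.length + t.length ≤ N + 1 → u ++ t = t ++ u → u ≠ [] → t ≠ [] →
        u.length ≤ t.length → ∃ (z : List α) (a b : ℕ), z ≠ [] ∧
          u = (List.replicate a z).flatten ∧ t = (List.replicate b z).flatten := by
      intro u t hN h hu ht hl
      obtain ⟨y, rfl⟩ : u <+: t :=
        List.prefix_of_prefix_length_le (List.prefix_append u t) (h ▸ List.prefix_append t u) hl
      have hul := List.length_pos_iff.2 hu
      rw [List.length_append] at hN
      rw [List.append_assoc] at h
      have h' : y ++ u = u ++ y := (List.append_cancel_left h).symm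
      obtain ⟨z, a, b, hz, ha, hb⟩ := ih y u (by omega) h' hu
      exact ⟨z, b, b + a, hz, hb, by rw [List.replicate_add, List.flatten_append, ← ha, ← hb]⟩
    rcases eq_or_ne u [] with rfl | hu
    · exact ⟨t, 0, 1, ht, by simp, by simp⟩
    · rcases le_total u.length t.length with hl | hl
      · exact key u t hN h hu ht hl
      · obtain ⟨z, a, b, hz, ha, hb⟩ := key t u (by omega) h.symm ht hu hl
        exact ⟨z, b, a, hz, hb, ha⟩

theorem IsPrimitive.append_ne {α : Type*} {u t : List α} (h : IsPrimitive (u ++ t)) (hu : u ≠ [])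
    (ht : t ≠ []) : u ++ t ≠ t ++ u := by
  intro hc
  obtain ⟨z, a, b, hz, rfl, rfl⟩ := exists_flatten_replicate_of_append_comm _ u t le_rfl hc ht
  have ha : a ≠ 0 := by rintro rfl; simp at hu
  have hb : b ≠ 0 := by rintro rfl; simp at ht
  exact h ⟨z, a + b, hz, by omega, by rw [List.replicate_add, List.flatten_append]⟩

theorem append_lt_append_left_iff {α : Type*} [LinearOrder α] (u : List α) {x y : List α} :
    u ++ x < u ++ y ↔ x < y := by
  induction u with
  | nil => simp
  | cons a u ih => simp [ih]

theorem lt_append_of_ne_nil {α : Type*} [LinearOrder α] (u : List α) {x : List α} (hx : x ≠ []) :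
    u < u ++ x := by
  have h := append_lt_append_left_iff u (x := []) (y := x)
  rw [List.append_nil] at h
  rw [h]
  cases x with
  | nil => exact absurd rfl hx
  | cons a x => exact List.nil_lt_cons a x

/-- If `x < y` and `x` is not a prefix of `y`, then the words differ at some position, so the
comparison survives whatever is appended to them. -/
theorem append_lt_append_of_not_prefix {α : Type*} [LinearOrder α] {x y : List α} (h : x < y)
    (hp : ¬ x <+: y) (u v : List α) : x ++ u < y ++ v := by
  induction x generalizing y with
  | nil => exact absurd List.nil_prefix hp
  | cons a x ih =>
    cases y with
    | nil => exact absurd h (List.not_lt_nil _)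
    | cons b y =>
      rw [List.cons_append, List.cons_append]
      rw [List.cons_lt_cons_iff] at h ⊢
      rcases h with h | ⟨rfl, h⟩
      · exact Or.inl h
      · exact Or.inr ⟨rfl, ih h fun hp' => hp (by simpa using hp')⟩

/-- A word is Lyndon iff it is nonempty and smaller than all its proper nonempty suffixes. -/
theorem isLyndon_iff_lt_suffix {α : Type*} [LinearOrder α] (w : List α) :
    IsLyndon w ↔ w ≠ [] ∧ ∀ u t : List α, w = u ++ t → u ≠ [] → t ≠ [] → w < t := by
  constructor
  · rintro ⟨hne, hprim, hrot⟩
    refine ⟨hne, ?_⟩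
    rintro u t rfl hu ht
    have h1 : u ++ t < t ++ u := by
      refine lt_of_le_of_ne ?_ (hprim.append_ne hu ht)
      simpa [List.rotate_append_length_eq] using hrot u.length
    by_contra hlt
    have hle : t < u ++ t := by
      refine lt_of_le_of_ne (not_lt.1 hlt) fun h => hu ?_
      have := congrArg List.length h
      simpa using this
    by_cases hp : t <+: u ++ t
    · obtain ⟨y, hy⟩ := hp
      rw [← hy, append_lt_append_left_iff] at h1
      have hlen : y.length = u.length := by
        have := congrArg List.length hy
        simp at this; omega
      have h2 : y ++ t < u ++ t := append_lt_append_of_not_prefix h1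
        (fun hp => h1.ne (hp.eq_of_length hlen)) t t
      have h3 : u ++ t ≤ y ++ t := by
        have := hrot t.length
        rwa [← hy, List.rotate_append_length_eq, hy] at this
      exact absurd h2 (not_lt.2 h3)
    · have := append_lt_append_of_not_prefix hle hp u []
      rw [List.append_nil] at this
      exact absurd this (not_lt.2 h1.le)
  · rintro ⟨hne, hsuf⟩
    refine ⟨hne, ?_, ?_⟩
    · rintro ⟨z, k, hz, hk, rfl⟩
      obtain ⟨k, rfl⟩ : ∃ j, k = j + 2 := ⟨k - 2, by omega⟩
      have hx : (List.replicate (k + 1) z).flatten ≠ [] := by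
        rw [List.replicate_succ, List.flatten_cons]; simp [hz]
      have h1 := hsuf (List.replicate (k + 1) z).flatten z
        (by rw [List.replicate_succ' (n := k + 1), List.flatten_concat]) hx hz
      have h2 := lt_append_of_ne_nil z hx
      rw [List.replicate_succ (n := k + 1), List.flatten_cons] at h1
      exact lt_asymm h1 h2
    · intro i
      rw [List.rotate_eq_drop_append_take_mod]
      set j := i % w.length
      have hj : j < w.length := Nat.mod_lt _ (List.length_pos_iff.2 hne)
      rcases Nat.eq_zero_or_pos j with h0 | h0
      · simp [h0]
      · have ht : w.take j ≠ [] := by simp [hne]; omega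
        have h1 := hsuf (w.take j) (w.drop j) (List.take_append_drop j w).symm ht
          (by simp; omega)
        exact (h1.trans (lt_append_of_ne_nil _ ht)).le

/-- The suffix of `s` at the position `i`, counted from `0`, is smaller than all later nonempty
suffixes. -/
def IsSuffixMin {α : Type*} [LinearOrder α] (s : List α) (i : ℕ) : Prop :=
  ∀ j, i < j → j < s.length → s.drop i < s.drop j

theorem isLyndon_drop_iff {α : Type*} [LinearOrder α] (s : List α) {i : ℕ} (hi : i < s.length) :
    IsLyndon (s.drop i) ↔ IsSuffixMin s i := by
  rw [isLyndon_iff_lt_suffix]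
  constructor
  · rintro ⟨-, h⟩ j hij hj
    refine h ((s.drop i).take (j - i)) (s.drop j) ?_ (by simp; omega) (by simp; omega)
    conv_lhs => rw [← List.take_append_drop (j - i) (s.drop i)]
    rw [List.drop_drop, Nat.add_sub_cancel' hij.le]
  · intro h
    refine ⟨by simp; omega, fun u t hut hu ht => ?_⟩
    have hlen : s.length - i = u.length + t.length := by
      have := congrArg List.length hut; simpa using this
    have hu' := List.length_pos_iff.2 hu
    have ht' := List.length_pos_iff.2 ht
    have htd : t = s.drop (i + u.length) := by
      rw [← List.drop_drop, hut, List.drop_left]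
    rw [htd]
    exact h _ (by omega) (by omega)

/-! ### The sorted list of suffixes and its left-to-right maxima -/

theorem suffixAt_injOn {α : Type*} (s : List α) {i j : ℕ} (hi : i ∈ List.range' 1 s.length)
    (hj : j ∈ List.range' 1 s.length) (h : suffixAt s i = suffixAt s j) : i = j := by
  rw [List.mem_range'_1] at hi hj
  have := congrArg List.length h
  simp only [suffixAt, List.length_drop] at this
  omega

theorem mem_suffixSort {α : Type*} [LinearOrder α] {s : List α} {T : Set ℕ} {i : ℕ} :
    i ∈ suffixSort s T ↔ i ∈ List.range' 1 s.length ∧ i ∈ T := by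
  simp [suffixSort]

theorem pairwise_suffixSort {α : Type*} [LinearOrder α] (s : List α) (T : Set ℕ) :
    (suffixSort s T).Pairwise (fun i j => suffixAt s i < suffixAt s j) := by
  have h1 : (suffixSort s T).Pairwise (fun i j => suffixAt s i ≤ suffixAt s j) := by
    have := List.pairwise_mergeSort
      (le := fun i j => decide (suffixAt s i ≤ suffixAt s j))
      (fun a b c hab hbc => by
        simp only [decide_eq_true_eq] at *; exact hab.trans hbc)
      (fun a b => by
        simp only [Bool.or_eq_true, decide_eq_true_eq]; exact le_total _ _)
      ((List.range' 1 s.length).filter (fun i => @decide (i ∈ T) (Classical.propDecidable _)))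
    exact this.imp fun h => by simpa using h
  have h2 : (suffixSort s T).Nodup :=
    (List.mergeSort_perm _ _).nodup_iff.2 (List.Nodup.filter _ List.nodup_range')
  refine (List.pairwise_and_iff.2 ⟨h1, h2⟩).imp_of_mem ?_
  rintro i j hi hj ⟨hle, hne⟩
  exact lt_of_le_of_ne hle fun h =>
    hne (suffixAt_injOn s (mem_suffixSort.1 hi).1 (mem_suffixSort.1 hj).1 h)

/-- Lists of positions that are sorted by their suffixes are determined by their elements. -/
theorem eq_of_pairwise_suffixAt_lt {α : Type*} [LinearOrder α] (s : List α) {l₁ l₂ : List ℕ}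
    (h₁ : l₁.Pairwise (fun i j => suffixAt s i < suffixAt s j))
    (h₂ : l₂.Pairwise (fun i j => suffixAt s i < suffixAt s j))
    (h : ∀ i, i ∈ l₁ ↔ i ∈ l₂) : l₁ = l₂ := by
  have nd : ∀ l : List ℕ, l.Pairwise (fun i j => suffixAt s i < suffixAt s j) → l.Nodup :=
    fun l hl => hl.imp fun {i j} hij => by rintro rfl; exact lt_irrefl _ hij
  exact List.Perm.eq_of_pairwise (fun a b _ _ hab hba => absurd hba (lt_asymm hab)) h₁ h₂
    ((List.perm_ext_iff_of_nodup (nd _ h₁) (nd _ h₂)).2 h)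

theorem isLyndon_suffixAt_iff {α : Type*} [LinearOrder α] (s : List α) {i : ℕ}
    (hi : i ∈ List.range' 1 s.length) :
    IsLyndon (suffixAt s i) ↔ ∀ j, i < j → j ≤ s.length → suffixAt s i < suffixAt s j := by
  rw [List.mem_range'_1] at hi
  rw [suffixAt, isLyndon_drop_iff s (by omega)]
  constructor
  · intro h j hij hj
    exact h (j - 1) (by omega) (by omega)
  · intro h j hij hj
    simpa [suffixAt] using h (j + 1) (by omega) (by omega)

open Classical in
/-- Lyndon suffixes are nested, so sorting them lexicographically lists their positions in
increasing order. -/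
theorem lyndonSuffixArray_eq_filter {α : Type*} [LinearOrder α] (s : List α) :
    lyndonSuffixArray s =
      (List.range' 1 s.length).filter (fun i => decide (IsLyndon (suffixAt s i))) := by
  refine eq_of_pairwise_suffixAt_lt s (pairwise_suffixSort s _) ?_ fun i => ?_
  · have h : ((List.range' 1 s.length).filter
        (fun i => decide (IsLyndon (suffixAt s i)))).Pairwise (· < ·) :=
      List.Pairwise.filter _ (List.pairwise_lt_range' (step := 1))
    refine h.imp_of_mem fun {i j} hi hj hij => ?_
    rw [List.mem_filter, decide_eq_true_eq] at hi hj
    exact (isLyndon_suffixAt_iff s hi.1).1 hi.2 j hij (by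
      have := hj.1; rw [List.mem_range'_1] at this; omega)
  · rw [lyndonSuffixArray, mem_suffixSort, List.mem_filter, decide_eq_true_eq, Set.mem_ofPred_eq]

open Classical in
/-- In a list sorted by an asymmetric relation, the entries before `i` are those related to `i`. -/
theorem leftToRightMaxima_eq_filter {r : ℕ → ℕ → Prop} [Std.Asymm r] {l : List ℕ}
    (h : l.Pairwise r) :
    leftToRightMaxima l = l.filter (fun i => decide (∀ j ∈ l, r j i → j < i)) := by
  induction l with
  | nil => rfl
  | cons x l ih =>
    rw [List.pairwise_cons] at h
    have hx : ∀ j ∈ x :: l, r j x → j < x := by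
      intro j hj hjx
      rcases List.mem_cons.1 hj with rfl | hj
      · exact absurd hjx (Std.Asymm.asymm _ _ hjx)
      · exact absurd hjx (Std.Asymm.asymm _ _ (h.1 j hj))
    rw [leftToRightMaxima, ih h.2, List.filter_cons_of_pos (by simpa using hx), List.filter_filter]
    congr 1
    refine List.filter_congr fun i hi => ?_
    have := h.1 i hi
    simp [this]

/-- A listed suffix is a left-to-right maximum iff no smaller suffix starts later, and the
smallest of the suffixes that start later is a Lyndon word. -/
theorem leftToRightMaxima_suffixSort {α : Type*} [LinearOrder α] (s : List α) (T : Set ℕ)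
    (hT : ∀ i, 1 ≤ i → i ≤ s.length → IsLyndon (suffixAt s i) → i ∈ T) :
    leftToRightMaxima (suffixSort s T) = lyndonSuffixArray s := by
  classical
  have hs := pairwise_suffixSort s T
  have : Std.Asymm (fun i j => suffixAt s i < suffixAt s j) := ⟨fun _ _ h => lt_asymm h⟩
  rw [leftToRightMaxima_eq_filter hs]
  refine eq_of_pairwise_suffixAt_lt s (hs.filter _) (pairwise_suffixSort s _) fun i => ?_
  simp only [lyndonSuffixArray, mem_suffixSort, List.mem_filter, decide_eq_true_eq,
    Set.mem_ofPred_eq]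
  constructor
  · rintro ⟨⟨hi, -⟩, h⟩
    refine ⟨hi, (isLyndon_suffixAt_iff s hi).2 ?_⟩
    by_contra! hc
    have hi' := List.mem_range'_1.1 hi
    obtain ⟨j₀, hj₀, hj₀', hlt⟩ := hc
    -- the smallest suffix among those that start at `i` or later
    obtain ⟨j, hj, hmin⟩ := Finset.exists_min_image (Finset.Icc i s.length) (suffixAt s)
      ⟨i, by simp; omega⟩
    rw [Finset.mem_Icc] at hj
    have hjr : j ∈ List.range' 1 s.length := by rw [List.mem_range'_1]; omega
    have hjL : IsLyndon (suffixAt s j) := by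
      refine (isLyndon_suffixAt_iff s hjr).2 fun k hk hk' => ?_
      refine lt_of_le_of_ne (hmin k (by rw [Finset.mem_Icc]; omega)) fun he => ?_
      exact hk.ne (suffixAt_injOn s hjr (by rw [List.mem_range'_1]; omega) he)
    have hlt' : suffixAt s j < suffixAt s i := by
      refine lt_of_le_of_ne ((hmin j₀ (by rw [Finset.mem_Icc]; omega)).trans hlt) fun he => ?_
      have h1 := suffixAt_injOn s hjr hi he
      subst h1
      have h2 : suffixAt s j = suffixAt s j₀ :=
        le_antisymm (hmin j₀ (by rw [Finset.mem_Icc]; omega)) hlt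
      exact hj₀.ne (suffixAt_injOn s hjr (by rw [List.mem_range'_1]; omega) h2)
    have := h j ⟨hjr, hT j (by omega) hj.2 hjL⟩ hlt'
    omega
  · rintro ⟨hi, hL⟩
    have hi' := List.mem_range'_1.1 hi
    refine ⟨⟨hi, hT i hi'.1 (by omega) hL⟩, fun j hj hji => ?_⟩
    have hj' := List.mem_range'_1.1 hj.1
    by_contra hij
    rcases eq_or_lt_of_le (not_lt.1 hij) with rfl | hij
    · exact lt_irrefl _ hji
    · exact lt_asymm hji ((isLyndon_suffixAt_iff s hi).1 hL j hij (by omega))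

/-! ### Comparing suffixes letter by letter -/

section Compare

variable {l : List ℕ}

theorem drop_eq_getD_cons {i : ℕ} (h : i < l.length) :
    l.drop i = l.getD i 0 :: l.drop (i + 1) := by
  rw [List.drop_eq_getElem_cons h, List.getD_eq_getElem _ _ h]

theorem drop_lt_drop_iff_of_agree {i j c : ℕ} (hi : i + c ≤ l.length) (hj : j + c ≤ l.length)
    (h : ∀ k < c, l.getD (i + k) 0 = l.getD (j + k) 0) :
    l.drop i < l.drop j ↔ l.drop (i + c) < l.drop (j + c) := by
  induction c with
  | zero => rfl
  | succ c ih =>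
    rw [ih (by omega) (by omega) (fun k hk => h k (by omega)),
      drop_eq_getD_cons (i := i + c) (by omega), drop_eq_getD_cons (i := j + c) (by omega),
      h c (by omega), List.cons_lt_cons_iff]
    simp [add_assoc]

theorem drop_lt_drop_of_mismatch {i j c : ℕ} (hi : i + c < l.length) (hj : j + c < l.length)
    (h : ∀ k < c, l.getD (i + k) 0 = l.getD (j + k) 0)
    (hc : l.getD (i + c) 0 < l.getD (j + c) 0) : l.drop i < l.drop j := by
  rw [drop_lt_drop_iff_of_agree hi.le hj.le h, drop_eq_getD_cons hi, drop_eq_getD_cons hj,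
    List.cons_lt_cons_iff]
  exact Or.inl hc

theorem drop_lt_drop_of_prefix {i j c : ℕ} (hi : i + c = l.length) (hj : j + c < l.length)
    (h : ∀ k < c, l.getD (i + k) 0 = l.getD (j + k) 0) : l.drop i < l.drop j := by
  rw [drop_lt_drop_iff_of_agree hi.le hj.le h, drop_eq_getD_cons hj, hi, List.drop_length]
  exact List.nil_lt_cons _ _

theorem getD_le_of_drop_lt_drop {i j c : ℕ} (hi : i + c < l.length) (hj : j + c < l.length)
    (h : ∀ k < c, l.getD (i + k) 0 = l.getD (j + k) 0) (hlt : l.drop i < l.drop j) :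
    l.getD (i + c) 0 ≤ l.getD (j + c) 0 := by
  by_contra! hc
  exact lt_asymm hlt (drop_lt_drop_of_mismatch hj hi (fun k hk => (h k hk).symm) hc)

/-- The suffixes at `i` and `j` agree on fewer than `c` letters, and then the one at `i` has the
smaller letter. -/
def LtWithin (l : List ℕ) (c i j : ℕ) : Prop :=
  ∃ k < c, (∀ k' < k, l.getD (i + k') 0 = l.getD (j + k') 0) ∧
    l.getD (i + k) 0 < l.getD (j + k) 0

theorem LtWithin.mono {c c' i j : ℕ} (h : LtWithin l c i j) (hc : c ≤ c') : LtWithin l c' i j :=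
  let ⟨k, hk, h'⟩ := h
  ⟨k, hk.trans_le hc, h'⟩

theorem agree_or_ltWithin {i j c : ℕ} (hi : i + c ≤ l.length) (hj : j + c ≤ l.length)
    (hlt : l.drop i < l.drop j) :
    (∀ k < c, l.getD (i + k) 0 = l.getD (j + k) 0) ∨ LtWithin l c i j := by
  induction c with
  | zero => exact Or.inl fun k hk => absurd hk (Nat.not_lt_zero k)
  | succ c ih =>
    rcases ih (by omega) (by omega) with h | h
    · rcases (getD_le_of_drop_lt_drop (by omega) (by omega) h hlt).eq_or_lt with he | hl
      · refine Or.inl fun k hk => ?_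
        rcases Nat.lt_succ_iff_lt_or_eq.1 hk with hk | rfl
        exacts [h k hk, he]
      · exact Or.inr ⟨c, by omega, h, hl⟩
    · exact Or.inr (h.mono (by omega))

/-! ### Periods of the prefixes of a Lyndon word -/

/-- `p` is the smallest period of the first `c` letters of the suffix at `m` (and `p = 1` if
`c = 0`). That no smaller shift is a period is recorded by the first mismatch, which in a Lyndon
word is always an increase. -/
structure IsPeriod (l : List ℕ) (m c p : ℕ) : Prop where
  pos : 0 < p
  le : p ≤ max c 1
  periodic : ∀ k, p + k < c → l.getD (m + (p + k)) 0 = l.getD (m + k) 0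
  minimal : ∀ e, 0 < e → e < p → LtWithin l (c - e) m (m + e)

theorem isPeriod_zero (m : ℕ) : IsPeriod l m 0 1 :=
  ⟨by omega, by omega, fun k hk => by omega, fun e h1 h2 => by omega⟩

variable {m c p : ℕ}

/-- In a Lyndon word, the letter that follows a prefix is not smaller than the letter that would
continue its period. -/
theorem IsPeriod.getD_le (h : IsPeriod l m c p) (hm : IsSuffixMin l m) (hc : m + c < l.length) :
    l.getD (m + (c - p)) 0 ≤ l.getD (m + c) 0 := by
  rcases Nat.eq_zero_or_pos c with rfl | hc0
  · simp
  have h1 := h.pos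
  have h2 := h.le
  have h3 := getD_le_of_drop_lt_drop (i := m) (j := m + p) (c := c - p) (by omega) (by omega)
    (fun k hk => by rw [add_assoc]; exact (h.periodic k (by omega)).symm)
    (hm (m + p) (by omega) (by omega))
  rwa [show m + p + (c - p) = m + c by omega] at h3

theorem IsPeriod.succ_of_eq (h : IsPeriod l m c p)
    (he : l.getD (m + (c - p)) 0 = l.getD (m + c) 0) : IsPeriod l m (c + 1) p := by
  have h1 := h.pos
  have h2 := h.le
  refine ⟨h1, by omega, fun k hk => ?_, fun e h3 h4 => (h.minimal e h3 h4).mono (by omega)⟩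
  rcases Nat.lt_succ_iff_lt_or_eq.1 hk with hk | hk
  · exact h.periodic k hk
  · rw [hk, he.symm, show c - p = k by omega]

theorem IsPeriod.succ_of_lt (h : IsPeriod l m c p) (hm : IsSuffixMin l m) (hc : m + c < l.length)
    (hlt : l.getD (m + (c - p)) 0 < l.getD (m + c) 0) : IsPeriod l m (c + 1) (c + 1) := by
  have h1 := h.pos
  have h2 := h.le
  have hcp : p ≤ c := by
    by_contra hcon
    obtain rfl : c = 0 := by omega
    simp at hlt
  refine ⟨by omega, by omega, fun k hk => by omega, fun e h3 h4 => ?_⟩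
  have hper : ∀ k, p + k < c → l.getD (m + p + k) 0 = l.getD (m + k) 0 := fun k hk => by
    rw [add_assoc]; exact h.periodic k hk
  rcases lt_trichotomy e p with h5 | rfl | h5
  · exact (h.minimal e h3 h5).mono (by omega)
  · refine ⟨c - e, by omega, fun k hk => (hper k (by omega)).symm, ?_⟩
    rwa [show m + e + (c - e) = m + c by omega]
  · -- the period moves the shift `e` to the shift `e - p`, where the word is compared with itself
    have hshift : ∀ k, e + k < c → l.getD (m + e + k) 0 = l.getD (m + (e - p) + k) 0 :=
      fun k hk => by
        have := hper (e - p + k) (by omega)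
        rwa [show m + p + (e - p + k) = m + e + k by omega, ← add_assoc] at this
    have hlt' := hm (m + (e - p)) (by omega) (by omega)
    rcases agree_or_ltWithin (c := c - e) (by omega) (by omega) hlt' with hag | ⟨k, hk, hag, hkl⟩
    · have hle := getD_le_of_drop_lt_drop (c := c - e) (by omega) (by omega) hag hlt'
      refine ⟨c - e, by omega, fun k hk => (hag k hk).trans (hshift k (by omega)).symm, ?_⟩
      rw [show m + (e - p) + (c - e) = m + (c - p) by omega] at hle
      rw [show m + e + (c - e) = m + c by omega]
      exact hle.trans_lt hlt
    · exact ⟨k, by omega, fun k' hk' => (hag k' hk').trans (hshift k' (by omega)).symm,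
        by rwa [hshift k (by omega)]⟩

/-! ### Comparing earlier suffixes with the smallest one

The first `c` letters of the suffix at `i` agree with those of the smallest suffix `m`. -/

variable {i : ℕ}

/-- If `x` is a proper prefix of a Lyndon word `v` then `x v < v`. -/
theorem drop_lt_of_agree_of_eq (hm : IsSuffixMin l m) (him : i < m) (hic : i + c = m)
    (hc : m + c < l.length) (h : ∀ k < c, l.getD (i + k) 0 = l.getD (m + k) 0) :
    l.drop i < l.drop m := by
  rw [drop_lt_drop_iff_of_agree (by omega) hc.le h, hic]
  exact hm _ (by omega) hc

theorem drop_le_drop_add (hm : IsSuffixMin l m) {e : ℕ} (he : m + e < l.length) :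
    l.drop m ≤ l.drop (m + e) := by
  rcases Nat.eq_zero_or_pos e with rfl | he0
  · exact le_rfl
  · exact (hm _ (by omega) he).le

/-- A mismatch with a larger letter disposes of all the positions up to the mismatch. -/
theorem lt_drop_of_mismatch (hm : IsSuffixMin l m) (him : i < m) (hc : m + c < l.length)
    (h : ∀ k < c, l.getD (i + k) 0 = l.getD (m + k) 0)
    (hlt : l.getD (m + c) 0 < l.getD (i + c) 0) {j : ℕ} (hij : i ≤ j) (hj : j ≤ i + c) :
    l.drop m < l.drop j := by
  obtain ⟨e, rfl⟩ := Nat.exists_eq_add_of_le hij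
  refine (drop_le_drop_add hm (e := e) (by omega)).trans_lt
    (drop_lt_drop_of_mismatch (c := c - e) (by omega) (by omega) (fun k hk => ?_) ?_)
  · rw [add_assoc, add_assoc]; exact (h _ (by omega)).symm
  · rwa [show m + e + (c - e) = m + c by omega, show i + e + (c - e) = i + c by omega]

/-- A full occurrence of the smallest suffix disposes of all the positions inside. -/
theorem lt_drop_of_occurrence (hm : IsSuffixMin l m) (him : i < m) (hc : m + c = l.length)
    (h : ∀ k < c, l.getD (i + k) 0 = l.getD (m + k) 0) {j : ℕ} (hij : i ≤ j) (hj : j < i + c) :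
    l.drop m < l.drop j := by
  obtain ⟨e, rfl⟩ := Nat.exists_eq_add_of_le hij
  refine (drop_le_drop_add hm (e := e) (by omega)).trans_lt
    (drop_lt_drop_of_prefix (c := c - e) (by omega) (by omega) (fun k hk => ?_))
  rw [add_assoc, add_assoc]; exact (h _ (by omega)).symm

/-- The positions inside an agreement of length `c` that are no multiples of a period can be
skipped. -/
theorem lt_drop_of_isPeriod (hp : IsPeriod l m c p) (him : i < m) (hc : m + c ≤ l.length)
    (h : ∀ k < c, l.getD (i + k) 0 = l.getD (m + k) 0) {j : ℕ} (hij : i < j) (hj : j < i + p) :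
    l.drop m < l.drop j := by
  obtain ⟨e, rfl⟩ := Nat.exists_eq_add_of_lt hij
  obtain ⟨k, hk, hag, hlt⟩ := hp.minimal (e + 1) (by omega) (by omega)
  have hsh : ∀ k' ≤ k, l.getD (m + (e + 1) + k') 0 = l.getD (i + e + 1 + k') 0 := fun k' hk' => by
    have := h (e + 1 + k') (by omega)
    rw [add_assoc m, ← this]; congr 1; omega
  exact drop_lt_drop_of_mismatch (c := k) (by omega) (by omega)
    (fun k' hk' => (hag k' hk').trans (hsh k' hk'.le)) (by rwa [← hsh k le_rfl])

/-- The agreement that is left after moving on by a period. -/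
theorem IsPeriod.agree (hp : IsPeriod l m c p)
    (h : ∀ k < c, l.getD (i + k) 0 = l.getD (m + k) 0) :
    ∀ k < c - p, l.getD (i + p + k) 0 = l.getD (m + k) 0 := fun k hk => by
  rw [add_assoc, h _ (by omega), hp.periodic k (by omega)]

end Compare

/-! ### The search for the next Lyndon suffix to the left -/

/-- State of the search for the last position in `[lo, m)` whose suffix is smaller than the one
at `m`: the positions before `i` are done, the suffix at `i` agrees with the one at `m` on `c`
letters, and `b` is the last success so far (`b = m` if there is none). -/
structure ScanInv (l : List ℕ) (lo m i c b : ℕ) : Prop where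
  lo_le : lo ≤ i
  le_m : i + c ≤ m
  le_length : m + c ≤ l.length
  agree : ∀ k < c, l.getD (i + k) 0 = l.getD (m + k) 0
  lo_le_b : lo ≤ b
  b_le : b ≤ m
  success : b < m → b < i ∧ l.drop b < l.drop m
  fail : ∀ j, lo ≤ j → j < i → b < j ∨ b = m → l.drop m < l.drop j

namespace ScanInv

variable {l : List ℕ} {lo m i c b : ℕ}

theorem start (hlo : lo ≤ m) (hm : m ≤ l.length) : ScanInv l lo m lo 0 m where
  lo_le := le_rfl
  le_m := hlo
  le_length := hm
  agree := fun k hk => absurd hk (Nat.not_lt_zero k)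
  lo_le_b := hlo
  b_le := le_rfl
  success := fun h => absurd h (lt_irrefl m)
  fail := fun j h1 h2 => by omega

theorem found (h : ScanInv l lo m i c b) {p : ℕ} (hp : IsPeriod l m c p) (him : i < m)
    (hlt : l.drop i < l.drop m) : ScanInv l lo m (i + p) (c - p) i where
  lo_le := h.lo_le.trans (Nat.le_add_right i p)
  le_m := by have := h.le_m; have := hp.le; omega
  le_length := by have := h.le_length; omega
  agree := hp.agree h.agree
  lo_le_b := h.lo_le
  b_le := him.le
  success := fun _ => ⟨by have := hp.pos; omega, hlt⟩
  fail := fun j _ h2 h3 => lt_drop_of_isPeriod hp him h.le_length h.agree (by omega) h2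

theorem mismatch (h : ScanInv l lo m i c b) (hm : IsSuffixMin l m) (hic : i + c < m)
    (hc : m + c < l.length) (hlt : l.getD (m + c) 0 < l.getD (i + c) 0) :
    ScanInv l lo m (i + c + 1) 0 b where
  lo_le := by have := h.lo_le; omega
  le_m := by omega
  le_length := by omega
  agree := fun k hk => absurd hk (Nat.not_lt_zero k)
  lo_le_b := h.lo_le_b
  b_le := h.b_le
  success := fun hb => ⟨by have := (h.success hb).1; omega, (h.success hb).2⟩
  fail := fun j h1 h2 h3 => by
    rcases lt_or_ge j i with hj | hj
    · exact h.fail j h1 hj h3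
    · exact lt_drop_of_mismatch hm (by omega) hc h.agree hlt hj (by omega)

theorem occurrence (h : ScanInv l lo m i c b) (hm : IsSuffixMin l m) (him : i < m)
    (hc : m + c = l.length) : ScanInv l lo m (i + c) 0 b where
  lo_le := by have := h.lo_le; omega
  le_m := h.le_m
  le_length := by omega
  agree := fun k hk => absurd hk (Nat.not_lt_zero k)
  lo_le_b := h.lo_le_b
  b_le := h.b_le
  success := fun hb => ⟨by have := (h.success hb).1; omega, (h.success hb).2⟩
  fail := fun j h1 h2 h3 => by
    rcases lt_or_ge j i with hj | hj
    · exact h.fail j h1 hj h3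
    · exact lt_drop_of_occurrence hm him hc h.agree hj h2

theorem extend (h : ScanInv l lo m i c b) (hic : i + c < m) (hc : m + c < l.length)
    (he : l.getD (i + c) 0 = l.getD (m + c) 0) : ScanInv l lo m i (c + 1) b where
  lo_le := h.lo_le
  le_m := hic
  le_length := hc
  agree := fun k hk => by
    rcases Nat.lt_succ_iff_lt_or_eq.1 hk with hk | rfl
    exacts [h.agree k hk, he]
  lo_le_b := h.lo_le_b
  b_le := h.b_le
  success := h.success
  fail := h.fail

end ScanInv

/-! ### Running times of word RAM programs -/

/-- Sequential composition of programs. -/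
local infixr:60 " ;; " => Prog.seq

theorem State.reg_setReg (st : State) (r v k : ℕ) :
    (st.setReg r v).reg k = if k = r then v else st.reg k := by
  simp [State.setReg, Function.update_apply]

theorem State.mem_setReg (st : State) (r v : ℕ) : (st.setReg r v).mem = st.mem := rfl

theorem State.reg_setMem (st : State) (a v : ℕ) : (st.setMem a v).reg = st.reg := rfl

theorem State.mem_setMem (st : State) (a v k : ℕ) :
    (st.setMem a v).mem k = if k = a then v else st.mem k := by
  simp [State.setMem, Function.update_apply]

/-- Total correctness with a time bound: `p` started in `st` halts after at most `T` steps in a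
state that satisfies `Q`. -/
def Run (W M : ℕ) (p : Prog) (st : State) (T : ℕ) (Q : State → Prop) : Prop :=
  ∃ st' t, Exec W M p st st' t ∧ t ≤ T ∧ Q st'

namespace Run

variable {W M : ℕ} {p q p' : Prog} {st : State} {T T' r a b c x : ℕ} {Q R : State → Prop}

theorem mono (h : Run W M p st T Q) (hT : T ≤ T') : Run W M p st T' Q :=
  let ⟨st', t, he, ht, hQ⟩ := h
  ⟨st', t, he, ht.trans hT, hQ⟩

theorem imp (h : Run W M p st T Q) (hQ : ∀ st', Q st' → R st') : Run W M p st T R :=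
  let ⟨st', t, he, ht, h'⟩ := h
  ⟨st', t, he, ht, hQ st' h'⟩

theorem seq (h : Run W M p st T (fun st' => Run W M q st' T' Q)) :
    Run W M (p ;; q) st (T + T') Q :=
  let ⟨_, _, he, ht, st₂, _, he', ht', hQ⟩ := h
  ⟨st₂, _, Exec.seq he he', Nat.add_le_add ht ht', hQ⟩

theorem skip (h : Q st) : Run W M Prog.skip st (T + 1) Q :=
  ⟨_, _, Exec.skip st, by omega, h⟩

theorem const (hW : c < W) (h : Q (st.setReg r c)) : Run W M (Prog.const r c) st (T + 1) Q :=
  ⟨_, _, Exec.const st r c hW, by omega, h⟩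

theorem add (hx : st.reg a + st.reg b = x) (hW : x < W) (h : Q (st.setReg r x)) :
    Run W M (Prog.add r a b) st (T + 1) Q :=
  ⟨_, _, Exec.add st r a b (hx ▸ hW), by omega, hx ▸ h⟩

theorem sub (hx : st.reg a - st.reg b = x) (h : Q (st.setReg r x)) :
    Run W M (Prog.sub r a b) st (T + 1) Q :=
  ⟨_, _, Exec.sub st r a b, by omega, hx ▸ h⟩

theorem load (hc : st.reg a = c) (hM : c < M) (hx : st.mem c = x) (h : Q (st.setReg r x)) :
    Run W M (Prog.load r a) st (T + 1) Q := by
  subst hc hx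
  exact ⟨_, _, Exec.load st r a hM, by omega, h⟩

theorem store (hc : st.reg a = c) (hM : c < M) (hx : st.reg r = x) (h : Q (st.setMem c x)) :
    Run W M (Prog.store a r) st (T + 1) Q := by
  subst hc hx
  exact ⟨_, _, Exec.store st a r hM, by omega, h⟩

theorem ite (h₁ : st.reg a < st.reg b → Run W M p st T Q)
    (h₂ : ¬ st.reg a < st.reg b → Run W M q st T Q) :
    Run W M (Prog.ite a b p q) st (T + 1) Q := by
  by_cases hc : st.reg a < st.reg b
  · obtain ⟨st', t, he, ht, hQ⟩ := h₁ hc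
    exact ⟨st', _, Exec.iteTrue hc he, by omega, hQ⟩
  · obtain ⟨st', t, he, ht, hQ⟩ := h₂ hc
    exact ⟨st', _, Exec.iteFalse hc he, by omega, hQ⟩

theorem cons (h : Run W M p st 1 (fun st' => Run W M q st' T Q)) :
    Run W M (p ;; q) st (T + 1) Q :=
  (seq h).mono (by omega)

theorem const_seq (hW : c < W) (h : Run W M q (st.setReg r c) T Q) :
    Run W M (Prog.const r c ;; q) st (T + 1) Q :=
  cons (const (T := 0) hW h)

theorem add_seq (hx : st.reg a + st.reg b = x) (hW : x < W) (h : Run W M q (st.setReg r x) T Q) :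
    Run W M (Prog.add r a b ;; q) st (T + 1) Q :=
  cons (add (T := 0) hx hW h)

theorem sub_seq (hx : st.reg a - st.reg b = x) (h : Run W M q (st.setReg r x) T Q) :
    Run W M (Prog.sub r a b ;; q) st (T + 1) Q :=
  cons (sub (T := 0) hx h)

theorem load_seq (hc : st.reg a = c) (hM : c < M) (hx : st.mem c = x)
    (h : Run W M q (st.setReg r x) T Q) : Run W M (Prog.load r a ;; q) st (T + 1) Q :=
  cons (load (T := 0) hc hM hx h)

theorem store_seq (hc : st.reg a = c) (hM : c < M) (hx : st.reg r = x)
    (h : Run W M q (st.setMem c x) T Q) : Run W M (Prog.store a r ;; q) st (T + 1) Q :=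
  cons (store (T := 0) hc hM hx h)

/-- A loop whose body pays for itself by decreasing the potential `Φ` under the invariant `I`. -/
theorem loop {I : State → Prop} (Φ : State → ℕ)
    (hbody : ∀ st, I st → st.reg a < st.reg b →
      ∃ T, Run W M p st T (fun st' => I st' ∧ Φ st' + T + 1 ≤ Φ st))
    (h : I st) :
    Run W M (Prog.loop a b p) st (Φ st + 1) (fun st' => I st' ∧ ¬ st'.reg a < st'.reg b) := by
  induction hN : Φ st using Nat.strong_induction_on generalizing st with
  | _ N ih =>
    subst hN
    by_cases hc : st.reg a < st.reg b
    · obtain ⟨T, st₁, t₁, he₁, ht₁, hI, hΦ⟩ := hbody st h hc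
      obtain ⟨st₂, t₂, he₂, ht₂, hQ⟩ := ih (Φ st₁) (by omega) hI rfl
      exact ⟨st₂, _, Exec.loopTrue hc he₁ he₂, by omega, hQ⟩
    · exact ⟨st, 1, Exec.loopFalse st hc, by omega, h, hc⟩

end Run

/-! ### The program

Registers `0`, `1`, `2` hold `0`, `1` and the length `n` of the input. Register `3` holds the
position `m` (counted from `0`) of the smallest suffix found so far, and register `4` the number
`B` of positions directly before `m` that are known not to start a smaller suffix. The input
occupies the cells `0, …, n`; register `5` points to `n` cells of marks, register `6` to `n + 1`
cells for smallest periods. The other registers are scratch: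
`7` = next value of `B`, `8` = text position, `9` = length of the table of periods,
`10` = length of the current agreement, `11` = period, `12` = last success, `13`, …, `16` =
addresses and letters. -/

/-- One step of the computation of the smallest periods of the prefixes of the suffix `v` at `m`.
As `v` is a Lyndon word, the next letter either continues the period or is larger than the letter
that would continue it, and in the latter case the whole prefix becomes its own smallest period.
The prefix of length `0` has the period `1` by convention, and the truncated difference `0 - 1`
makes the first letter continue it. -/
def periodBody : Prog :=
  Prog.add 13 3 10 ;; Prog.add 13 13 1 ;; Prog.load 14 13 ;;
  Prog.sub 13 10 11 ;; Prog.add 13 13 3 ;; Prog.add 13 13 1 ;; Prog.load 15 13 ;;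
  Prog.add 10 10 1 ;; Prog.ite 15 14 (Prog.add 11 10 0) Prog.skip ;;
  Prog.add 13 6 10 ;; Prog.store 13 11

/-- The suffix at the text position is smaller than the one at `m`: record it and move on by the
smallest period of the current agreement (by `1` if there is no agreement). -/
def successBody : Prog :=
  Prog.add 12 8 0 ;; Prog.add 13 6 10 ;; Prog.load 11 13 ;; Prog.add 8 8 11 ;; Prog.sub 10 10 11

/-- One step of the search to the left of `m`. -/
def scanBody : Prog :=
  Prog.add 13 8 10 ;; Prog.add 16 3 10 ;;
  Prog.ite 16 2
    (Prog.ite 13 3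
      (Prog.add 13 13 1 ;; Prog.load 14 13 ;; Prog.add 16 16 1 ;; Prog.load 15 16 ;;
        Prog.ite 14 15 successBody
          (Prog.ite 15 14 (Prog.add 8 13 0 ;; Prog.const 10 0) (Prog.add 10 10 1)))
      successBody)
    (Prog.add 8 13 0 ;; Prog.const 10 0)

/-- Look for a smaller suffix among the `2 * B + 1` positions before `m`. If there is one, mark the
last one and go on from there with `B = 0`, otherwise go on with `2 * B + 1` in place of `B`. -/
def stageBody : Prog :=
  Prog.add 7 4 4 ;; Prog.add 7 7 1 ;; Prog.sub 8 3 7 ;; Prog.sub 9 3 8 ;; Prog.sub 13 2 3 ;;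
  Prog.ite 13 9 (Prog.add 9 13 0) Prog.skip ;;
  Prog.const 10 0 ;; Prog.const 11 1 ;; Prog.store 6 11 ;;
  Prog.loop 10 9 periodBody ;;
  Prog.const 10 0 ;; Prog.add 12 3 0 ;;
  Prog.loop 8 3 scanBody ;;
  Prog.ite 12 3
    (Prog.add 3 12 0 ;; Prog.add 13 5 3 ;; Prog.store 13 1 ;; Prog.const 4 0)
    (Prog.add 4 7 0)

/-- Append the next position to the output if it is marked. -/
def outputBody : Prog :=
  Prog.add 13 5 8 ;; Prog.load 14 13 ;; Prog.add 8 8 1 ;;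
  Prog.ite 0 14 (Prog.add 10 10 1 ;; Prog.store 10 8) Prog.skip

/-- Computes the Lyndon suffix array: marks the Lyndon suffixes from right to left and then lists
the marked positions. -/
def lyndonProg : Prog :=
  Prog.const 1 1 ;; Prog.load 2 0 ;; Prog.add 5 2 1 ;; Prog.add 6 5 2 ;;
  Prog.ite 0 2
    (Prog.sub 3 2 1 ;; Prog.add 13 5 3 ;; Prog.store 13 1) Prog.skip ;;
  Prog.loop 4 3 stageBody ;;
  Prog.const 10 0 ;; Prog.const 8 0 ;;
  Prog.loop 8 2 outputBody ;;
  Prog.store 0 10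

/-! ### Marking the Lyndon suffixes -/

/-- The registers and cells that the inner loops do not change: `mk` is the content of the
marks. -/
structure Ctx (l : List ℕ) (mk : ℕ → ℕ) (m B : ℕ) (st : State) : Prop where
  reg0 : st.reg 0 = 0
  reg1 : st.reg 1 = 1
  reg2 : st.reg 2 = l.length
  reg3 : st.reg 3 = m
  reg4 : st.reg 4 = B
  reg5 : st.reg 5 = l.length + 1
  reg6 : st.reg 6 = 2 * l.length + 1
  letters : ∀ i < l.length, st.mem (i + 1) = l.getD i 0
  marks : ∀ i < l.length, st.mem (l.length + 1 + i) = mk i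

section Correctness

variable {l : List ℕ} {mk : ℕ → ℕ} {m B : ℕ} {st : State} {W M : ℕ}

theorem Ctx.setReg (h : Ctx l mk m B st) {r : ℕ} (hr : 7 ≤ r) (v : ℕ) :
    Ctx l mk m B (st.setReg r v) := by
  have hne : ∀ k, k < 7 → (st.setReg r v).reg k = st.reg k := fun k hk => by
    rw [State.reg_setReg, if_neg (by omega)]
  constructor <;> first
    | exact h.letters
    | exact h.marks
    | (rw [hne _ (by norm_num)]; first
        | exact h.reg0 | exact h.reg1 | exact h.reg2 | exact h.reg3 | exact h.reg4
        | exact h.reg5 | exact h.reg6)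

theorem Ctx.setMem (h : Ctx l mk m B st) {a : ℕ} (ha : 2 * l.length + 1 ≤ a) (v : ℕ) :
    Ctx l mk m B (st.setMem a v) where
  reg0 := h.reg0
  reg1 := h.reg1
  reg2 := h.reg2
  reg3 := h.reg3
  reg4 := h.reg4
  reg5 := h.reg5
  reg6 := h.reg6
  letters i hi := by rw [State.mem_setMem, if_neg (by omega)]; exact h.letters i hi
  marks i hi := by rw [State.mem_setMem, if_neg (by omega)]; exact h.marks i hi

/-- The invariant of the computation of the periods: the table is correct up to the length in
register `10`. -/
structure PeriodInv (l : List ℕ) (mk : ℕ → ℕ) (m B D lo L : ℕ) (st : State) : Prop where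
  ctx : Ctx l mk m B st
  reg7 : st.reg 7 = D
  reg8 : st.reg 8 = lo
  reg9 : st.reg 9 = L
  le : st.reg 10 ≤ L
  period : IsPeriod l m (st.reg 10) (st.reg 11)
  table : ∀ c ≤ st.reg 10, IsPeriod l m c (st.mem (2 * l.length + 1 + c))

variable {D lo L : ℕ}

theorem run_periodBody (hW : 4 * l.length + 4 ≤ W) (hM : 4 * l.length + 4 ≤ M)
    (hm : IsSuffixMin l m) (hL : m + L ≤ l.length) (h : PeriodInv l mk m B D lo L st)
    (hc : st.reg 10 < st.reg 9) :
    Run W M periodBody st 12 (fun st' => PeriodInv l mk m B D lo L st' ∧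
      st'.reg 10 = st.reg 10 + 1) := by
  obtain ⟨ctx, h7, h8, h9, hle, hper, htab⟩ := h
  obtain ⟨r0, r1, r2, r3, r4, r5, r6, hlet, hmk⟩ := id ctx
  generalize hcc : st.reg 10 = c at *
  generalize hpp : st.reg 11 = p at *
  have hx := hlet (m + c) (by omega)
  have hy := hlet (m + (c - p)) (by omega)
  unfold periodBody
  refine Run.add_seq (x := m + c) (by simp [*]) (by omega) ?_
  refine Run.add_seq (x := m + c + 1) (by simp [State.reg_setReg, *]) (by omega) ?_
  refine Run.load_seq (c := m + c + 1) (by simp [State.reg_setReg]) (by omega) hx ?_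
  refine Run.sub_seq (x := c - p) (by simp [State.reg_setReg, *]) ?_
  refine Run.add_seq (x := m + (c - p)) (by simp [State.reg_setReg, *]; omega) (by omega) ?_
  refine Run.add_seq (x := m + (c - p) + 1) (by simp [State.reg_setReg, *]) (by omega) ?_
  refine Run.load_seq (c := m + (c - p) + 1) (by simp [State.reg_setReg]) (by omega) hy ?_
  refine Run.add_seq (x := c + 1) (by simp [State.reg_setReg, *]) (by omega) ?_
  -- both branches leave the new period in register `11` and then store it
  have tail : ∀ st' p', Ctx l mk m B st' → st'.reg 7 = D → st'.reg 8 = lo → st'.reg 9 = L →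
      st'.reg 10 = c + 1 → st'.reg 11 = p' → st'.mem = st.mem → IsPeriod l m (c + 1) p' →
      Run W M (Prog.add 13 6 10 ;; Prog.store 13 11) st' 2 (fun st' =>
        PeriodInv l mk m B D lo L st' ∧ st'.reg 10 = c + 1) := by
    intro st' p' ctx' h7' h8' h9' h10 h11 hmem hp'
    refine Run.add_seq (x := 2 * l.length + 1 + (c + 1)) (by rw [ctx'.reg6, h10]) (by omega) ?_
    refine Run.store (c := 2 * l.length + 1 + (c + 1)) (x := p') (by simp [State.reg_setReg])
      (by omega) (by simpa [State.reg_setReg] using h11) ?_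
    refine ⟨⟨(ctx'.setReg (by norm_num) _).setMem (by omega) _, ?_, ?_, ?_, ?_, ?_, ?_⟩, ?_⟩
    all_goals simp only [State.reg_setReg, State.reg_setMem, h7', h8', h9', h10, h11]
    all_goals try norm_num
    · omega
    · exact hp'
    · intro k hk
      rw [State.mem_setMem, State.mem_setReg, hmem]
      split_ifs with hk'
      · obtain rfl : k = c + 1 := by omega
        exact hp'
      · exact htab k (by omega)
  refine Run.seq (T := 2) (T' := 2) (Run.ite (fun hlt => ?_) (fun hlt => ?_))
  · have hlt' : l.getD (m + (c - p)) 0 < l.getD (m + c) 0 := by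
      simpa [State.reg_setReg] using hlt
    refine Run.add (x := c + 1) (by simp [State.reg_setReg, *]) (by omega) ?_
    refine tail _ (c + 1) ?_ ?_ ?_ ?_ ?_ ?_ rfl (hper.succ_of_lt hm (by omega) hlt')
    · iterate 9 refine Ctx.setReg ?_ (by norm_num) _
      exact ctx
    all_goals simp [State.reg_setReg, *]
  · have hge : ¬ l.getD (m + (c - p)) 0 < l.getD (m + c) 0 := by
      simpa [State.reg_setReg] using hlt
    refine Run.skip (tail _ p ?_ ?_ ?_ ?_ ?_ ?_ rfl (hper.succ_of_eq ?_))
    · iterate 8 refine Ctx.setReg ?_ (by norm_num) _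
      exact ctx
    · simp [State.reg_setReg, *]
    · simp [State.reg_setReg, *]
    · simp [State.reg_setReg, *]
    · simp [State.reg_setReg, *]
    · simp [State.reg_setReg, *]
    · exact le_antisymm (hper.getD_le hm (by omega)) (not_lt.1 hge)

/-- The table of the smallest periods takes time linear in its length. -/
theorem run_periodLoop (hW : 4 * l.length + 4 ≤ W) (hM : 4 * l.length + 4 ≤ M)
    (hm : IsSuffixMin l m) (hL : m + L ≤ l.length) (h : PeriodInv l mk m B D lo L st) :
    Run W M (Prog.loop 10 9 periodBody) st (13 * L + 1)
      (fun st' => PeriodInv l mk m B D lo L st' ∧ st'.reg 10 = L) := by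
  refine ((Run.loop (I := PeriodInv l mk m B D lo L) (fun st => 13 * (L - st.reg 10))
    (fun st' h' hc => ⟨12, ?_⟩) h).mono (by omega)).imp ?_
  · refine (run_periodBody hW hM hm hL h' hc).imp fun st₁ h₁ => ⟨h₁.1, ?_⟩
    have := h₁.1.le
    have := h₁.2
    omega
  · rintro st' ⟨h', hc⟩
    exact ⟨h', by have := h'.le; have := h'.reg9; omega⟩

/-- The invariant of the search to the left of `m`. -/
structure ScanState (l : List ℕ) (mk : ℕ → ℕ) (m B D lo L : ℕ) (st : State) : Prop where
  ctx : Ctx l mk m B st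
  reg7 : st.reg 7 = D
  scan : ScanInv l lo m (st.reg 8) (st.reg 10) (st.reg 12)
  table : ∀ c ≤ L, IsPeriod l m c (st.mem (2 * l.length + 1 + c))

theorem run_successBody (hW : 4 * l.length + 4 ≤ W) (hM : 4 * l.length + 4 ≤ M)
    (h : ScanState l mk m B D lo L st) (hml : m < l.length)
    (hL : st.reg 10 ≤ L) (him : st.reg 8 < m) (hlt : l.drop (st.reg 8) < l.drop m) :
    Run W M successBody st 5 (fun st' => ScanState l mk m B D lo L st' ∧
      2 * st.reg 8 + st.reg 10 < 2 * st'.reg 8 + st'.reg 10) := by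
  obtain ⟨ctx, h7, hs, htab⟩ := h
  have hper := htab _ hL
  generalize hcc : st.reg 10 = c at *
  generalize hii : st.reg 8 = i at *
  obtain ⟨r0, r1, r2, r3, r4, r5, r6, -, -⟩ := id ctx
  have hle := hs.le_m
  have hpl := hper.le
  have hpp := hper.pos
  generalize hp : st.mem (2 * l.length + 1 + c) = p at *
  unfold successBody
  refine Run.add_seq (x := i) (by simp [*]) (by omega) ?_
  refine Run.add_seq (x := 2 * l.length + 1 + c) (by simp [State.reg_setReg, *]) (by omega) ?_
  refine Run.load_seq (c := 2 * l.length + 1 + c) (by simp [State.reg_setReg]) (by omega) hp ?_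
  refine Run.add_seq (x := i + p) (by simp [State.reg_setReg, *]) (by omega) ?_
  refine Run.sub (x := c - p) (by simp [State.reg_setReg, *]) ?_
  refine ⟨⟨?_, ?_, ?_, htab⟩, ?_⟩
  · iterate 5 refine Ctx.setReg ?_ (by norm_num) _
    exact ctx
  · simp [State.reg_setReg, *]
  · simpa [State.reg_setReg] using hs.found hper him hlt
  · simp [State.reg_setReg]
    omega

theorem run_scanBody (hW : 4 * l.length + 4 ≤ W) (hM : 4 * l.length + 4 ≤ M)
    (hm : IsSuffixMin l m) (hml : m < l.length) (hL : m - lo ≤ L ∨ l.length - m ≤ L)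
    (h : ScanState l mk m B D lo L st) (hc : st.reg 8 < st.reg 3) :
    Run W M scanBody st 14 (fun st' => ScanState l mk m B D lo L st' ∧
      2 * st.reg 8 + st.reg 10 < 2 * st'.reg 8 + st'.reg 10) := by
  obtain ⟨ctx, h7, hs, htab⟩ := id h
  obtain ⟨r0, r1, r2, r3, r4, r5, r6, hlet, hmk⟩ := id ctx
  have h8 : ∃ i, st.reg 8 = i := ⟨_, rfl⟩
  have h10 : ∃ c, st.reg 10 = c := ⟨_, rfl⟩
  obtain ⟨i, h8⟩ := h8
  obtain ⟨c, h10⟩ := h10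
  rw [h8, r3] at hc
  rw [h8, h10] at hs ⊢
  have hle := hs.le_m
  have hle' := hs.le_length
  have hlo := hs.lo_le
  unfold scanBody
  refine Run.add_seq (x := i + c) (by simp [*]) (by omega) ?_
  refine Run.add_seq (x := m + c) (by simp [State.reg_setReg, *]) (by omega) ?_
  have hfound : ∀ st', ScanState l mk m B D lo L st' → st'.reg 8 = i → st'.reg 10 = c →
      l.drop i < l.drop m → Run W M successBody st' 5 (fun st' => ScanState l mk m B D lo L st' ∧
        2 * i + c < 2 * st'.reg 8 + st'.reg 10) := by
    intro st' h' h8' h10' hlt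
    have := run_successBody hW hM h' hml (by omega) (by omega) (by rwa [h8'])
    rwa [h8', h10'] at this
  refine Run.ite (T := 11) (fun h1 => ?_) (fun h1 => ?_)
  · replace h1 : m + c < l.length := by simpa [State.reg_setReg, r2] using h1
    refine Run.ite (T := 10) (fun h2 => ?_) (fun h2 => ?_)
    · replace h2 : i + c < m := by simpa [State.reg_setReg, r3] using h2
      have hx := hlet (i + c) (by omega)
      have hy := hlet (m + c) (by omega)
      refine Run.add_seq (x := i + c + 1) (by simp [State.reg_setReg, *]) (by omega) ?_
      refine Run.load_seq (c := i + c + 1) (by simp [State.reg_setReg]) (by omega) hx ?_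
      refine Run.add_seq (x := m + c + 1) (by simp [State.reg_setReg, *]) (by omega) ?_
      refine Run.load_seq (c := m + c + 1) (by simp [State.reg_setReg]) (by omega) hy ?_
      refine Run.ite (T := 5) (fun h3 => ?_) (fun h3 => ?_)
      · replace h3 : l.getD (i + c) 0 < l.getD (m + c) 0 := by
          simpa [State.reg_setReg] using h3
        refine hfound _ ⟨?_, ?_, ?_, htab⟩ ?_ ?_
          (drop_lt_drop_of_mismatch (by omega) h1 hs.agree h3)
        · iterate 6 refine Ctx.setReg ?_ (by norm_num) _
          exact ctx
        all_goals simp [State.reg_setReg, *]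
      · replace h3 : ¬ l.getD (i + c) 0 < l.getD (m + c) 0 := by
          simpa [State.reg_setReg] using h3
        refine Run.ite (T := 4) (fun h4 => ?_) (fun h4 => ?_)
        · replace h4 : l.getD (m + c) 0 < l.getD (i + c) 0 := by
            simpa [State.reg_setReg] using h4
          refine Run.add_seq (x := i + c + 1) (by simp [State.reg_setReg, *]) (by omega) ?_
          refine Run.const (by omega) ?_
          refine ⟨⟨?_, ?_, ?_, htab⟩, ?_⟩
          · iterate 8 refine Ctx.setReg ?_ (by norm_num) _
            exact ctx
          · simp [State.reg_setReg, *]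
          · simpa [State.reg_setReg] using hs.mismatch hm h2 h1 h4
          · simp [State.reg_setReg]
            omega
        · replace h4 : ¬ l.getD (m + c) 0 < l.getD (i + c) 0 := by
            simpa [State.reg_setReg] using h4
          refine Run.add (x := c + 1) (by simp [State.reg_setReg, *]) (by omega) ?_
          refine ⟨⟨?_, ?_, ?_, htab⟩, ?_⟩
          · iterate 7 refine Ctx.setReg ?_ (by norm_num) _
            exact ctx
          · simp [State.reg_setReg, *]
          · simpa [State.reg_setReg, h8] using
              hs.extend h2 h1 (le_antisymm (not_lt.1 h4) (not_lt.1 h3))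
          · simp [State.reg_setReg, h8]
    · replace h2 : ¬ i + c < m := by simpa [State.reg_setReg, r3] using h2
      refine Run.mono (T := 5) ?_ (by norm_num)
      refine hfound _ ⟨?_, ?_, ?_, htab⟩ ?_ ?_
        (drop_lt_of_agree_of_eq hm hc (by omega) h1 hs.agree)
      · iterate 2 refine Ctx.setReg ?_ (by norm_num) _
        exact ctx
      all_goals simp [State.reg_setReg, *]
  · replace h1 : ¬ m + c < l.length := by simpa [State.reg_setReg, r2] using h1
    refine Run.add_seq (T := 10) (x := i + c) (by simp [State.reg_setReg, *]) (by omega) ?_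
    refine Run.const (by omega) ?_
    refine ⟨⟨?_, ?_, ?_, htab⟩, ?_⟩
    · iterate 4 refine Ctx.setReg ?_ (by norm_num) _
      exact ctx
    · simp [State.reg_setReg, *]
    · simpa [State.reg_setReg] using hs.occurrence hm hc (by omega)
    · simp [State.reg_setReg]
      omega

/-- The search takes time linear in the number of positions searched: the number
`2 * i + c`, where `c` is the length of the agreement at the text position `i`, increases in every
step and stays at most `2 * m`. -/
theorem run_scanLoop (hW : 4 * l.length + 4 ≤ W) (hM : 4 * l.length + 4 ≤ M)
    (hm : IsSuffixMin l m) (hml : m < l.length) (hL : m - lo ≤ L ∨ l.length - m ≤ L)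
    (h : ScanState l mk m B D lo L st) (h8 : st.reg 8 = lo) :
    Run W M (Prog.loop 8 3 scanBody) st (30 * (m - lo) + 1)
      (fun st' => ScanState l mk m B D lo L st' ∧ m ≤ st'.reg 8) := by
  refine ((Run.loop (I := ScanState l mk m B D lo L)
    (fun st => 15 * (2 * m - (2 * st.reg 8 + st.reg 10)))
    (fun st' h' hc => ⟨14, ?_⟩) h).mono (by omega)).imp ?_
  · refine (run_scanBody hW hM hm hml hL h' hc).imp fun st₁ h₁ => ⟨h₁.1, ?_⟩
    have := h₁.1.scan.le_m
    have := h₁.2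
    omega
  · rintro st' ⟨h', hc⟩
    exact ⟨h', by have := h'.ctx.reg3; omega⟩

open Classical in
/-- The marks after the positions from `m` on have been dealt with. -/
noncomputable def marksFrom (l : List ℕ) (m i : ℕ) : ℕ :=
  if m ≤ i ∧ IsSuffixMin l i then 1 else 0

theorem marksFrom_eq_of_lt {b : ℕ} (hb : IsSuffixMin l b) (hbm : b < m)
    (hm : m < l.length) (hfail : ∀ j, b < j → j < m → l.drop m < l.drop j) {i : ℕ} :
    marksFrom l b i = if i = b then 1 else marksFrom l m i := by
  unfold marksFrom
  by_cases hib : i = b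
  · simp [hib, hb]
  rw [if_neg hib]
  have h : b ≤ i ∧ IsSuffixMin l i ↔ m ≤ i ∧ IsSuffixMin l i := by
    refine and_congr_left fun hi => ⟨fun h => ?_, fun h => by omega⟩
    by_contra hcon
    exact lt_asymm (hi m (by omega) hm) (hfail i (by omega) (by omega))
  by_cases h' : m ≤ i ∧ IsSuffixMin l i
  · rw [if_pos h', if_pos (h.2 h')]
  · rw [if_neg h', if_neg (mt h.1 h')]

/-- The invariant of the main loop. -/
structure MainInv (l : List ℕ) (st : State) : Prop where
  ctx : Ctx l (marksFrom l (st.reg 3)) (st.reg 3) (st.reg 4) st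
  lt : st.reg 3 < l.length
  le : st.reg 4 ≤ 2 * l.length
  isMin : IsSuffixMin l (st.reg 3)
  fail : ∀ j < st.reg 3, st.reg 3 ≤ j + st.reg 4 → l.drop (st.reg 3) < l.drop j

/-- A stage takes time proportional to `B + 1`, where `B` is the content of register `4`. It either
decreases `m` by more than `B`, or increases `B` by `B + 1`; so `200 * m - 100 * B` decreases by
at least `100 * (B + 1)`. -/
theorem run_stageBody (hW : 4 * l.length + 4 ≤ W) (hM : 4 * l.length + 4 ≤ M)
    (h : MainInv l st) (hc : st.reg 4 < st.reg 3) :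
    Run W M stageBody st (100 * st.reg 4 + 99) (fun st' => MainInv l st' ∧
      200 * st'.reg 3 + 100 * (2 * l.length - st'.reg 4) + 100 * (st.reg 4 + 1) ≤
        200 * st.reg 3 + 100 * (2 * l.length - st.reg 4)) := by
  obtain ⟨ctx, hml, hB, hm, hfail⟩ := h
  generalize st.reg 3 = m at *
  generalize st.reg 4 = B at *
  obtain ⟨r0, r1, r2, r3, r4, r5, r6, hlet, hmk⟩ := id ctx
  have hlo : ∃ lo, m - (2 * B + 1) = lo := ⟨_, rfl⟩
  obtain ⟨lo, hlo⟩ := hlo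
  -- the length of the table of periods
  have hL : ∃ L, min (m - lo) (l.length - m) = L := ⟨_, rfl⟩
  obtain ⟨L, hL⟩ := hL
  -- what follows the computation of `L`
  have rest : ∀ st', Ctx l (marksFrom l m) m B st' → st'.reg 7 = 2 * B + 1 → st'.reg 8 = lo →
      st'.reg 9 = L → Run W M (Prog.const 10 0 ;; Prog.const 11 1 ;; Prog.store 6 11 ;;
        Prog.loop 10 9 periodBody ;; Prog.const 10 0 ;; Prog.add 12 3 0 ;;
        Prog.loop 8 3 scanBody ;; Prog.ite 12 3
          (Prog.add 3 12 0 ;; Prog.add 13 5 3 ;; Prog.store 13 1 ;; Prog.const 4 0)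
          (Prog.add 4 7 0)) st' ((13 * L + 1 + ((30 * (m - lo) + 1 + 5) + 2)) + 3) (fun st' =>
        MainInv l st' ∧ 200 * st'.reg 3 + 100 * (2 * l.length - st'.reg 4) + 100 * (B + 1) ≤
          200 * m + 100 * (2 * l.length - B)) := by
    intro st₁ ctx₁ h7 h8 h9
    refine Run.const_seq (by omega) (Run.const_seq (by omega) ?_)
    refine Run.store_seq (c := 2 * l.length + 1) (x := 1)
      (by simp [State.reg_setReg, ctx₁.reg6]) (by omega) (by simp [State.reg_setReg]) ?_
    refine Run.seq ((run_periodLoop (m := m) (B := B) (D := 2 * B + 1) (lo := lo) (L := L)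
      (mk := marksFrom l m) hW hM hm (by omega) ?_).imp ?_)
    · refine ⟨?_, ?_, ?_, ?_, ?_, ?_, ?_⟩
      · exact ((ctx₁.setReg (by norm_num) _).setReg (by norm_num) _).setMem (by omega) _
      · simp [State.reg_setReg, State.reg_setMem, h7]
      · simp [State.reg_setReg, State.reg_setMem, h8]
      · simp [State.reg_setReg, State.reg_setMem, h9]
      · simp [State.reg_setReg, State.reg_setMem]
      · simpa [State.reg_setReg, State.reg_setMem] using isPeriod_zero m
      · intro c hc
        obtain rfl : c = 0 := by simpa [State.reg_setReg, State.reg_setMem] using hc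
        simpa [State.mem_setMem] using isPeriod_zero m
    rintro st₂ ⟨⟨ctx₂, h7', h8', h9', -, -, htab⟩, h10⟩
    rw [h10] at htab
    refine Run.const_seq (by omega) ?_
    refine Run.add_seq (x := m) (by simp [State.reg_setReg, ctx₂.reg3, ctx₂.reg0]) (by omega) ?_
    refine Run.seq (T := 30 * (m - lo) + 1) (T' := 5) ((run_scanLoop (m := m) (B := B) (D := 2 * B + 1) (lo := lo) (L := L)
      (mk := marksFrom l m) hW hM hm hml (by omega) ?_ ?_).imp ?_)
    · refine ⟨(ctx₂.setReg (by norm_num) _).setReg (by norm_num) _, ?_, ?_, htab⟩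
      · simp [State.reg_setReg, h7']
      · simpa [State.reg_setReg, h8'] using ScanInv.start (l := l) (by omega) hml.le
    · simp [State.reg_setReg, h8']
    rintro st₃ ⟨⟨ctx₃, h7'', hs, -⟩, h8''⟩
    obtain ⟨q0, q1, q2, q3, q4, q5, q6, qlet, qmk⟩ := id ctx₃
    have him : st₃.reg 8 = m := by have := hs.le_m; omega
    rw [him] at hs
    obtain ⟨b, h12⟩ : ∃ b, st₃.reg 12 = b := ⟨_, rfl⟩
    rw [h12] at hs
    have hbm := hs.b_le
    refine Run.ite (T := 4) (fun hlt => ?_) (fun hlt => ?_)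
    · rw [h12, q3] at hlt
      have hbB : b + B < m := by
        by_contra hcon
        exact lt_asymm (hs.success hlt).2 (hfail b hlt (by omega))
      have hlob := hs.lo_le_b
      have hfail' : ∀ j, b < j → j < m → l.drop m < l.drop j :=
        fun j h1 h2 => hs.fail j (by omega) h2 (Or.inl h1)
      have hmin : IsSuffixMin l b := fun j h1 h2 => by
        rcases lt_trichotomy j m with h3 | rfl | h3
        · exact (hs.success hlt).2.trans (hfail' j h1 h3)
        · exact (hs.success hlt).2
        · exact (hs.success hlt).2.trans (hm j h3 h2)
      refine Run.add_seq (x := b) (by simp [*]) (by omega) ?_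
      refine Run.add_seq (x := l.length + 1 + b) (by simp [State.reg_setReg, *]) (by omega) ?_
      refine Run.store_seq (c := l.length + 1 + b) (x := 1) (by simp [State.reg_setReg])
        (by omega) (by simp [State.reg_setReg, *]) ?_
      refine Run.const (by omega) ?_
      have e3 : (((((st₃.setReg 3 b).setReg 13 (l.length + 1 + b)).setMem (l.length + 1 + b)
          1)).setReg 4 0).reg 3 = b := by simp [State.reg_setReg, State.reg_setMem]
      have e4 : (((((st₃.setReg 3 b).setReg 13 (l.length + 1 + b)).setMem (l.length + 1 + b)
          1)).setReg 4 0).reg 4 = 0 := by simp [State.reg_setReg]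
      refine ⟨⟨?_, ?_, ?_, ?_, ?_⟩, ?_⟩ <;> simp only [e3, e4]
      · constructor
        any_goals simp [State.reg_setReg, State.reg_setMem, *]
        · intro i hi
          rw [State.mem_setReg, State.mem_setMem, if_neg (by omega)]
          exact qlet i hi
        · intro i hi
          rw [State.mem_setReg, State.mem_setMem, State.mem_setReg, State.mem_setReg,
            marksFrom_eq_of_lt hmin hlt hml hfail', qmk i hi]
          simp
      · omega
      · omega
      · exact hmin
      · intro j h1 h2
        omega
      · omega
    · rw [h12, q3] at hlt
      obtain rfl : b = m := by omega
      refine Run.add (x := 2 * B + 1) (by simp [*]) (by omega) ?_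
      have e3 : (st₃.setReg 4 (2 * B + 1)).reg 3 = b := by simp [State.reg_setReg, *]
      have e4 : (st₃.setReg 4 (2 * B + 1)).reg 4 = 2 * B + 1 := by simp [State.reg_setReg]
      refine ⟨⟨?_, ?_, ?_, ?_, ?_⟩, ?_⟩ <;> simp only [e3, e4]
      · constructor
        any_goals simp [State.reg_setReg, *]
        · exact qlet
        · exact qmk
      · exact hml
      · omega
      · exact hm
      · intro j h1 h2
        exact hs.fail j (by omega) h1 (Or.inr rfl)
      · omega
  unfold stageBody
  refine Run.mono (T := (13 * L + 1 + ((30 * (m - lo) + 1 + 5) + 2)) + 3 + 2 + 1 + 1 + 1 + 1 + 1)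
    ?_ (by omega)
  refine Run.add_seq (x := B + B) (by simp [*]) (by omega) ?_
  refine Run.add_seq (x := 2 * B + 1) (by simp [State.reg_setReg, *]; omega) (by omega) ?_
  refine Run.sub_seq (x := lo) (by simp [State.reg_setReg, *]) ?_
  refine Run.sub_seq (x := m - lo) (by simp [State.reg_setReg, *]) ?_
  refine Run.sub_seq (x := l.length - m) (by simp [State.reg_setReg, *]) ?_
  have hctx : ∀ a b c d e, Ctx l (marksFrom l m) m B (((((st.setReg 7 a).setReg 7 b).setReg 8
      c).setReg 9 d).setReg 13 e) := fun a b c d e => by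
    iterate 5 refine Ctx.setReg ?_ (by norm_num) _
    exact ctx
  refine (Run.seq (T := 2) (T' := (13 * L + 1 + ((30 * (m - lo) + 1 + 5) + 2)) + 3)
    (Run.ite (fun hlt => ?_) (fun hlt => ?_))).mono (by omega)
  · replace hlt : l.length - m < m - lo := by simpa [State.reg_setReg] using hlt
    refine Run.add (x := L) (by simp [State.reg_setReg, *]; omega) (by omega) (rest _ ?_ ?_ ?_ ?_)
    · exact (hctx _ _ _ _ _).setReg (by norm_num) _
    all_goals simp [State.reg_setReg]
  · replace hlt : ¬ l.length - m < m - lo := by simpa [State.reg_setReg] using hlt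
    refine Run.skip (rest _ (hctx _ _ _ _ _) ?_ ?_ ?_)
    all_goals simp [State.reg_setReg]
    omega

/-- The main loop takes linear time and leaves exactly the Lyndon suffixes marked. -/
theorem run_mainLoop (hW : 4 * l.length + 4 ≤ W) (hM : 4 * l.length + 4 ≤ M)
    (h : MainInv l st) :
    Run W M (Prog.loop 4 3 stageBody) st (400 * l.length + 1)
      (fun st' => ∃ m B, Ctx l (marksFrom l 0) m B st') := by
  refine ((Run.loop (I := MainInv l)
    (fun st => 200 * st.reg 3 + 100 * (2 * l.length - st.reg 4))
    (fun st' h' hc => ⟨100 * st'.reg 4 + 99, ?_⟩) h).mono ?_).imp ?_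
  · refine (run_stageBody hW hM h' hc).imp fun st₁ h₁ => ⟨h₁.1, ?_⟩
    have := h₁.2
    omega
  · have := h.lt
    omega
  · rintro st' ⟨h', hc⟩
    refine ⟨_, _, { h'.ctx with marks := fun i hi => ?_ }⟩
    rw [h'.ctx.marks i hi]
    classical
    by_cases hi' : st'.reg 3 ≤ i
    · simp [marksFrom, hi']
    · have := h'.fail i (by omega) (by omega)
      have hn : ¬ IsSuffixMin l i := fun hmin =>
        lt_asymm this (hmin _ (by omega) h'.lt)
      simp [marksFrom, hn]

/-! ### Writing out the marked positions -/

/-- The invariant of the output loop: the first `i` positions (`i` in register `8`) have been dealt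
with, and `k` of them (`k` in register `10`) have been written to the output. The output never
overtakes `i`, so it does not touch the marks. -/
structure OutputInv (l : List ℕ) (mk : ℕ → ℕ) (st : State) : Prop where
  reg0 : st.reg 0 = 0
  reg1 : st.reg 1 = 1
  reg2 : st.reg 2 = l.length
  reg5 : st.reg 5 = l.length + 1
  le : st.reg 8 ≤ l.length
  count_le : st.reg 10 ≤ st.reg 8
  marks : ∀ i < l.length, st.mem (l.length + 1 + i) = mk i
  output : (List.range' 1 (st.reg 10)).map st.mem =
    (List.range' 1 (st.reg 8)).filter (fun i => decide (0 < mk (i - 1)))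

theorem run_outputBody (hW : 4 * l.length + 4 ≤ W) (hM : 4 * l.length + 4 ≤ M)
    (h : OutputInv l mk st) (hc : st.reg 8 < st.reg 2) :
    Run W M outputBody st 6 (fun st' => OutputInv l mk st' ∧ st'.reg 8 = st.reg 8 + 1) := by
  obtain ⟨r0, r1, r2, r5, hle, hcount, hmk, hout⟩ := h
  obtain ⟨i, h8⟩ : ∃ i, st.reg 8 = i := ⟨_, rfl⟩
  obtain ⟨k, h10⟩ : ∃ k, st.reg 10 = k := ⟨_, rfl⟩
  rw [h8] at hle hcount hout hc ⊢
  rw [h10] at hcount hout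
  rw [r2] at hc
  have hx := hmk i hc
  have hrange : List.range' 1 (i + 1) = List.range' 1 i ++ [i + 1] := by
    rw [List.range'_concat]; simp [add_comm]
  unfold outputBody
  refine Run.add_seq (x := l.length + 1 + i) (by simp [*]) (by omega) ?_
  refine Run.load_seq (c := l.length + 1 + i) (by simp [State.reg_setReg]) (by omega) hx ?_
  refine Run.add_seq (x := i + 1) (by simp [State.reg_setReg, *]) (by omega) ?_
  refine Run.ite (T := 2) (fun hlt => ?_) (fun hlt => ?_)
  · replace hlt : 0 < mk i := by simpa [State.reg_setReg, r0] using hlt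
    refine Run.add_seq (x := k + 1) (by simp [State.reg_setReg, *]) (by omega) ?_
    refine Run.store (c := k + 1) (x := i + 1) (by simp [State.reg_setReg]) (by omega)
      (by simp [State.reg_setReg]) ?_
    refine ⟨⟨?_, ?_, ?_, ?_, ?_, ?_, ?_, ?_⟩, ?_⟩
    any_goals simp [State.reg_setReg, State.reg_setMem, *] <;> done
    · intro j hj
      rw [State.mem_setMem, if_neg (by omega)]
      exact hmk j hj
    · have hk : (List.range' 1 k).map (((((st.setReg 13 (l.length + 1 + i)).setReg 14
          (mk i)).setReg 8 (i + 1)).setReg 10 (k + 1)).setMem (k + 1) (i + 1)).mem =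
          (List.range' 1 k).map st.mem := by
        refine List.map_congr_left fun j hj => ?_
        rw [List.mem_range'_1] at hj
        rw [State.mem_setMem, if_neg (by omega)]
        rfl
      have hrange' : List.range' 1 (k + 1) = List.range' 1 k ++ [k + 1] := by
        rw [List.range'_concat]; simp [add_comm]
      have e8 : (((((st.setReg 13 (l.length + 1 + i)).setReg 14
          (mk i)).setReg 8 (i + 1)).setReg 10 (k + 1)).setMem (k + 1) (i + 1)).reg 8 = i + 1 := by
        simp [State.reg_setReg, State.reg_setMem]
      have e10 : (((((st.setReg 13 (l.length + 1 + i)).setReg 14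
          (mk i)).setReg 8 (i + 1)).setReg 10 (k + 1)).setMem (k + 1) (i + 1)).reg 10 = k + 1 := by
        simp [State.reg_setReg, State.reg_setMem]
      rw [e8, e10, hrange, hrange', List.map_append, hk, hout, List.filter_append]
      simp [State.mem_setMem, hlt]
  · replace hlt : ¬ 0 < mk i := by simpa [State.reg_setReg, r0] using hlt
    refine Run.skip ⟨⟨?_, ?_, ?_, ?_, ?_, ?_, ?_, ?_⟩, ?_⟩
    any_goals simp [State.reg_setReg, *] <;> done
    · simp [State.reg_setReg, h10]; omega
    · exact hmk
    · have e8 : (((st.setReg 13 (l.length + 1 + i)).setReg 14 (mk i)).setReg 8 (i + 1)).reg 8 =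
          i + 1 := by simp [State.reg_setReg]
      have e10 : (((st.setReg 13 (l.length + 1 + i)).setReg 14 (mk i)).setReg 8 (i + 1)).reg 10 =
          k := by simp [State.reg_setReg, h10]
      rw [e8, e10, hrange, List.filter_append, ← hout]
      simpa [State.mem_setReg] using hlt

/-- The program runs in linear time; `marksFrom l 0` marks exactly the Lyndon suffixes. -/
theorem run_lyndonProg (hW : 4 * l.length + 4 ≤ W) (hM : 4 * l.length + 4 ≤ M) :
    Run W M lyndonProg (inputState l) (407 * l.length + 20) (fun st => st.output =
      (List.range' 1 l.length).filter (fun i => decide (0 < marksFrom l 0 (i - 1)))) := by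
  have hmem : ∀ i < l.length, (inputState l).mem (i + 1) = l.getD i 0 := fun i hi => by
    simp [inputState]
  -- the output pass
  have out : ∀ st m B, Ctx l (marksFrom l 0) m B st →
      Run W M (Prog.const 10 0 ;; Prog.const 8 0 ;; Prog.loop 8 2 outputBody ;; Prog.store 0 10)
        st (7 * l.length + 1 + 1 + 1 + 1) (fun st => st.output = (List.range' 1 l.length).filter
          (fun i => decide (0 < marksFrom l 0 (i - 1)))) := by
    intro st m B ctx
    refine Run.const_seq (by omega) (Run.const_seq (by omega) ?_)
    refine Run.seq (T := 7 * l.length + 1) (T' := 1) (((Run.loop (I := OutputInv l (marksFrom l 0))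
      (fun st => 7 * (l.length - st.reg 8)) (fun st' h' hc => ⟨6, ?_⟩) ?_).mono ?_).imp ?_)
    · refine (run_outputBody hW hM h' hc).imp fun st₁ h₁ => ⟨h₁.1, ?_⟩
      have := h₁.1.le
      have := h₁.2
      omega
    · constructor
      any_goals simp [State.reg_setReg, ctx.reg0, ctx.reg1, ctx.reg2, ctx.reg5]
      exact ctx.marks
    · simp [State.reg_setReg]
    · rintro st' ⟨h', hc⟩
      have h8 : st'.reg 8 = l.length := by have := h'.le; have := h'.reg2; omega
      have := h'.count_le
      refine Run.store (c := 0) (x := st'.reg 10) h'.reg0 (by omega) rfl ?_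
      rw [← h8, ← h'.output, State.output, State.mem_setMem, if_pos rfl]
      refine List.map_congr_left fun j hj => ?_
      rw [List.mem_range'_1] at hj
      rw [State.mem_setMem, if_neg (by omega)]
  unfold lyndonProg
  refine Run.const_seq (T := 407 * l.length + 19) (by omega) ?_
  refine Run.load_seq (T := 407 * l.length + 18) (c := 0) (x := l.length)
    (by simp [State.reg_setReg, inputState]) (by omega)
    (by simp [State.mem_setReg, inputState]) ?_
  refine Run.add_seq (T := 407 * l.length + 17) (x := l.length + 1) (by simp [State.reg_setReg])
    (by omega) ?_
  refine Run.add_seq (T := 407 * l.length + 16) (x := 2 * l.length + 1)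
    (by simp [State.reg_setReg]; omega) (by omega) ?_
  -- the main loop and the output pass
  have main : ∀ st, MainInv l st → Run W M (Prog.loop 4 3 stageBody ;; Prog.const 10 0 ;;
      Prog.const 8 0 ;; Prog.loop 8 2 outputBody ;; Prog.store 0 10) st (407 * l.length + 5)
      (fun st => st.output = (List.range' 1 l.length).filter
        (fun i => decide (0 < marksFrom l 0 (i - 1)))) := fun st hst =>
    (Run.seq ((run_mainLoop hW hM hst).imp fun st' ⟨m, B, ctx⟩ => out st' m B ctx)).mono (by omega)
  refine (Run.seq (T := 4) (T' := 407 * l.length + 5)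
    (Run.ite (T := 3) (fun hlt => ?_) (fun hlt => ?_))).mono (by omega)
  · replace hlt : 0 < l.length := by simpa [State.reg_setReg, inputState] using hlt
    refine Run.sub_seq (x := l.length - 1) (by simp [State.reg_setReg]) ?_
    refine Run.add_seq (x := l.length + 1 + (l.length - 1)) (by simp [State.reg_setReg])
      (by omega) ?_
    refine Run.store (c := l.length + 1 + (l.length - 1)) (x := 1) (by simp [State.reg_setReg])
      (by omega) (by simp [State.reg_setReg]) (main _ ?_)
    have hmin : IsSuffixMin l (l.length - 1) := fun j h1 h2 => by omega
    have hzero : ∀ i, l.length ≤ i → (inputState l).mem (i + 1) = 0 := fun i hi => by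
      simp [inputState, hi]
    have hmarks : ∀ i < l.length, marksFrom l (l.length - 1) i =
        if i = l.length - 1 then 1 else 0 := fun i hi => by
      unfold marksFrom
      by_cases hi' : i = l.length - 1
      · subst hi'
        rw [if_pos ⟨le_rfl, hmin⟩, if_pos rfl]
      · rw [if_neg (fun h => by have := h.1; omega), if_neg hi']
    generalize hst : State.setMem _ _ _ = st'
    have q3 : st'.reg 3 = l.length - 1 := by
      simp [← hst, State.reg_setReg, State.reg_setMem]
    have q4 : st'.reg 4 = 0 := by
      simp [← hst, State.reg_setReg, State.reg_setMem, inputState]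
    constructor
    · rw [q3, q4]
      constructor
      case reg3 => exact q3
      case reg4 => exact q4
      case letters =>
        intro i hi
        rw [← hst, State.mem_setMem, if_neg (by omega)]
        exact hmem i hi
      case marks =>
        intro i hi
        rw [hmarks i hi, ← hst, State.mem_setMem]
        refine if_congr (by omega) rfl ?_
        have := hzero (l.length + i) (by omega)
        rwa [show l.length + i + 1 = l.length + 1 + i by omega] at this
      all_goals simp [← hst, State.reg_setReg, State.reg_setMem, inputState]
    · omega
    · omega
    · rwa [q3]
    · intro j h1 h2
      omega
  · replace hlt : l = [] := by simpa [State.reg_setReg, inputState] using hlt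
    subst hlt
    refine Run.skip ((Run.seq (T := 1) (T' := 7 * 0 + 1 + 1 + 1 + 1)
      ⟨_, _, Exec.loopFalse _ ?_, le_rfl, out _ 0 0 ?_⟩).mono (by simp))
    · simp [State.reg_setReg, inputState]
    · constructor <;> simp [State.reg_setReg, inputState]

/-! ### Letters and their ranks -/

theorem rank_lt_rank_iff {α : Type*} [LinearOrder α] [Fintype α] {a b : α} :
    rank a < rank b ↔ a < b := by
  have key : ∀ {a b : α}, a < b → rank a < rank b := fun {a b} h => by
    refine Finset.card_lt_card (Finset.ssubset_iff_of_subset (fun x hx => ?_) |>.2 ⟨a, ?_, ?_⟩)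
    · simp only [Finset.mem_filter, Finset.mem_univ, true_and] at hx ⊢
      exact hx.trans h
    · simpa using h
    · simp
  refine ⟨fun h => ?_, key⟩
  by_contra hc
  rcases (not_lt.1 hc).eq_or_lt with rfl | h'
  · exact lt_irrefl _ h
  · exact lt_asymm h (key h')

theorem map_rank_lt_map_rank_iff {α : Type*} [LinearOrder α] [Fintype α] {x y : List α} :
    x.map rank < y.map rank ↔ x < y := by
  have hlt : ∀ {x y : List α}, x < y → x.map rank < y.map rank := fun h =>
    List.map_lt (fun _ _ hab => rank_lt_rank_iff.2 hab) h
  refine ⟨fun h => ?_, hlt⟩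
  by_contra hc
  rcases (not_lt.1 hc).eq_or_lt with rfl | h'
  · exact lt_irrefl _ h
  · exact lt_asymm h (hlt h')

theorem isSuffixMin_map_rank_iff {α : Type*} [LinearOrder α] [Fintype α] (s : List α) (i : ℕ) :
    IsSuffixMin (s.map rank) i ↔ IsSuffixMin s i := by
  simp only [IsSuffixMin, List.length_map, ← List.map_drop, map_rank_lt_map_rank_iff]

theorem run_lyndonProg_map_rank {α : Type*} [LinearOrder α] [Fintype α] (s : List α) :
    Run (500 * (s.length + Fintype.card α + 1)) (500 * (s.length + 1)) lyndonProg
      (inputState (s.map rank)) (500 * (s.length + 1))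
      (fun st => st.output = lyndonSuffixArray s) := by
  have hlen : (s.map (rank (α := α))).length = s.length := List.length_map _
  refine ((run_lyndonProg (l := s.map rank) (by omega) (by omega)).mono (by omega)).imp
    fun st hst => ?_
  rw [hst, lyndonSuffixArray_eq_filter, hlen]
  refine List.filter_congr fun i hi => ?_
  rw [List.mem_range'_1] at hi
  rw [suffixAt]
  have h : IsLyndon (s.drop (i - 1)) ↔ 0 < marksFrom (s.map rank) 0 (i - 1) := by
    rw [isLyndon_drop_iff s (by omega), ← isSuffixMin_map_rank_iff, marksFrom]
    split_ifs with h <;> simpa using h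
  simp [h]

end Correctness

end LyndonSA

theorem mainTheorem2 :
    -- one program computes the Lyndon suffix array of every string in linear time and space
    (∃ (P : LyndonSA.Prog) (C : ℕ),
      ∀ (α : Type*) [LinearOrder α] [Fintype α] (s : List α),
        ∃ (st : LyndonSA.State) (t : ℕ),
          LyndonSA.Exec (C * (s.length + Fintype.card α + 1)) (C * (s.length + 1)) P
            (LyndonSA.inputState (s.map LyndonSA.rank)) st t ∧
          t ≤ C * (s.length + 1) ∧
          st.output = LyndonSA.lyndonSuffixArray s) ∧
    -- the positions in the Lyndon suffix array increase, and they are what is left of a sorted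
    -- list of suffixes (among them all the Lyndon ones) when only the increasing sequence is kept
    (∀ (α : Type*) [LinearOrder α] [Fintype α] (s : List α),
      (LyndonSA.lyndonSuffixArray s).Pairwise (· < ·) ∧
      ∀ T : Set ℕ,
        (∀ i, 1 ≤ i → i ≤ s.length → LyndonSA.IsLyndon (LyndonSA.suffixAt s i) → i ∈ T) →
        LyndonSA.leftToRightMaxima (LyndonSA.suffixSort s T) = LyndonSA.lyndonSuffixArray s) := by
  refine ⟨⟨LyndonSA.lyndonProg, 500, fun α _ _ s => ?_⟩, fun α _ _ s => ⟨?_, fun T hT => ?_⟩⟩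
  · exact LyndonSA.run_lyndonProg_map_rank s
  · rw [LyndonSA.lyndonSuffixArray_eq_filter]
    exact List.Pairwise.filter _ (List.pairwise_lt_range' (step := 1))
  · exact LyndonSA.leftToRightMaxima_suffixSort s T hT
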